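/- Notation. For a Schwartz function $q:\mathbb R\to\mathbb C$ put $r=-\bar q$ and $$M=\int_{\mathbb R} qr\,dx,\qquad H_{\mathrm{DNLS}}=\int_{\mathbb R}\Big(-i\,qr'+\tfrac12 q^2r^2\Big)dx,\qquad E_{\mathrm{DNLS}}=\int_{\mathbb R}\Big(q'r'-\tfrac32 i\,q^2rr'+\tfrac12 q^3r^3\Big)dx .$$ For $s\ge 0$ let $\|q\|_{H^s}^2=\int_{\mathbb R}(4+\xi^2)^s|\hat q(\xi)|^2\,d\xi$ with $\hat q(\xi)=(2\pi)^{-1/2}\int e^{-i\xi x}q(x)\,dx$, so that $\|q\|_{H^0}=\|q\|_{L^2}$. For $\kappa\in\mathbb C\setminus\{0\}$ with $i\kappa^2\in\mathbb R$ define on $L^2(\mathbb R)$ the operators $$\Lambda=(\partial+i\kappa^2)^{-1/2}\,\kappa q\,(\partial-i\kappa^2)^{-1/2},\qquad \Gamma=(\partial-i\kappa^2)^{-1/2}\,\kappa r\,(\partial+i\kappa^2)^{-1/2},$$ where $(\partial\pm i\kappa^2)^{-1/2}$ is the Fourier multiplier with symbol $(i\xi\pm i\kappa^2)^{-1/2}$,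 with $z^{-1/2}=|z|^{-1/2}e^{-\frac i2\arg z}$ and $\arg z\in(-\pi,\pi]$, and set $$A(\kappa)=\sum_{m=1}^\infty A_m(\kappa),\qquad A_m(\kappa)=-\operatorname{sgn}(i\kappa^2)\,\frac1m\,\operatorname{tr}\big\{(\Lambda\Gamma)^m\big\}.$$ Lemma (asymptotic expansion of $A(\kappa)$). There is $\delta>0$ such that for every $s\in[0,\tfrac12)$ and every Schwartz function $q$ with $\|q\|_{H^s}\le\delta$ the following holds. For all $\kappa\in\mathbb C$ with $i\kappa^2\in\mathbb R$ and $|\kappa|\ge1$, the operators $\Lambda,\Gamma$ are Hilbert–Schmidt, the powers $(\Lambda\Gamma)^m$, $m\ge1$, are of trace class, and the series defining $A(\kappa)$ converges absolutely; and, as $|\kappa|\to\infty$ with $i\kappa^2\in\mathbb R$, $$A(\kappa)=(-i)\frac{M}{2}-\frac{(-i)^2}{2i\kappa^2}\,\frac{H_{\mathrm{DNLS}}}{2}+\frac{(-i)^3}{(2i\kappa^2)^2}\,\frac{E_{\mathrm{DNLS}}}{2}+O(|\kappa|^{-6}),$$ where the implicit constant may depend on $q$. -/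

import Mathlib

open MeasureTheory Complex Filter Asymptotics
open scoped SchwartzMap FourierTransform Topology ENNReal InnerProductSpace

noncomputable section

namespace DNLS

/-- The Hilbert space `L²(ℝ; ℂ)`. -/
abbrev L2 : Type := Lp ℂ 2 (volume : Measure ℝ)

/-! ### Multiplication operators and Fourier multipliers on `L²(ℝ)` -/

open Classical in
/-- The operator `f ↦ a f` of multiplication by an essentially bounded function `a` on `L²(ℝ)`
(and `0` if `a` is not in `L^∞`). -/
def mulOp (a : ℝ → ℂ) : L2 →L[ℂ] L2 :=
  if h : MemLp a ∞ (volume : Measure ℝ) then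
    (ContinuousLinearMap.mul ℂ ℂ).holderL (volume : Measure ℝ) ∞ 2 2 (h.toLp a)
  else 0

theorem mulOp_apply_ae {a : ℝ → ℂ} (h : MemLp a ∞ (volume : Measure ℝ)) (f : L2) :
    mulOp a f =ᵐ[volume] fun x => a x * f x := by
  have h1 : mulOp a f = (ContinuousLinearMap.mul ℂ ℂ).holder 2 (h.toLp a) f := by
    rw [mulOp, dif_pos h]
    rfl
  rw [h1]
  filter_upwards [(ContinuousLinearMap.mul ℂ ℂ).coeFn_holder (r := 2) (h.toLp a) f,
    h.coeFn_toLp] with x hx hx'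
  rw [hx, hx']
  rfl

/-- The Fourier multiplier `𝓕⁻¹ m(ξ) 𝓕` on `L²(ℝ)` with symbol `m`, the frequency being normalized
such that `∂` has the symbol `iξ`. (Mathlib's Fourier transform uses the phase `e^{-2πi x η}`,
that is `ξ = 2πη`.) -/
def fourierMult (m : ℝ → ℂ) : L2 →L[ℂ] L2 :=
  ((Lp.fourierTransformₗᵢ ℝ ℂ).symm.toContinuousLinearEquiv : L2 →L[ℂ] L2) ∘L
    mulOp (fun η : ℝ => m (2 * Real.pi * η)) ∘L
    ((Lp.fourierTransformₗᵢ ℝ ℂ).toContinuousLinearEquiv : L2 →L[ℂ] L2)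

/-- The operator `(∂ + c)^{-1/2}` as the Fourier multiplier with symbol `(iξ + c)^{-1/2}`, where
`z^{-1/2} = |z|^{-1/2} e^{-i arg(z)/2}` with `arg z ∈ (-π, π]`. -/
def rsqrtD (c : ℂ) : L2 →L[ℂ] L2 :=
  fourierMult fun ξ => (I * ξ + c) ^ (-(1 / 2) : ℂ)

/-- For real `c ≠ 0` the symbol of `(∂ + c)^{-1/2}` is bounded, so that the
definition of `rsqrtD` is the intended one. -/
theorem memLp_rsqrtD_symbol {c : ℂ} (hc : c.im = 0) (hc0 : c ≠ 0) :
    MemLp (fun η : ℝ => (I * ((2 * Real.pi * η : ℝ) : ℂ) + c) ^ (-(1 / 2) : ℂ)) ∞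
      (volume : Measure ℝ) := by
  have hre : c.re ≠ 0 := fun h => hc0 (Complex.ext (by simpa using h) (by simpa using hc))
  refine memLp_top_of_bound ?_ (|c.re| ^ (-(1 / 2) : ℝ)) (Eventually.of_forall fun η => ?_)
  · apply Measurable.aestronglyMeasurable
    apply Measurable.pow_const
    fun_prop
  · set z : ℂ := I * ((2 * Real.pi * η : ℝ) : ℂ) + c with hz
    have hzre : z.re = c.re := by
      rw [hz, Complex.add_re, Complex.mul_re, Complex.I_re, Complex.I_im, Complex.ofReal_im]
      ring
    have hz0 : z ≠ 0 := fun h => hre (by rw [← hzre, h]; rfl)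
    have hexp : (-(1 / 2) : ℂ) = ((-(1 / 2) : ℝ) : ℂ) := by push_cast; ring
    rw [hexp, Complex.norm_cpow_of_ne_zero hz0]
    simp only [Complex.ofReal_re, Complex.ofReal_im, mul_zero, Real.exp_zero, div_one]
    refine Real.rpow_le_rpow_of_nonpos (abs_pos.mpr hre) ?_ (by norm_num)
    rw [← hzre]
    exact Complex.abs_re_le_norm z

/-! ### Hilbert–Schmidt operators, trace class operators and the trace -/

/-- The index set of a fixed orthonormal basis of `L²(ℝ)`. -/
def basisSet : Set L2 := (exists_hilbertBasis ℂ L2).choose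

/-- A fixed orthonormal (Hilbert) basis of `L²(ℝ)`. -/
def basis : HilbertBasis basisSet ℂ L2 := (exists_hilbertBasis ℂ L2).choose_spec.choose

/-- `T` is Hilbert–Schmidt: `∑ ‖T e_i‖² < ∞` for an orthonormal basis `(e_i)` (this does not depend
on the basis). -/
def IsHilbertSchmidt (T : L2 →L[ℂ] L2) : Prop :=
  Summable fun i => ‖T (basis i)‖ ^ 2

/-- `T` is of trace class: it is a product of two Hilbert–Schmidt operators. -/
def IsTraceClass (T : L2 →L[ℂ] L2) : Prop :=
  ∃ S₁ S₂ : L2 →L[ℂ] L2, IsHilbertSchmidt S₁ ∧ IsHilbertSchmidt S₂ ∧ T = S₁ ∘L S₂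

/-- The trace `∑ ⟨e_i, T e_i⟩` of a trace class operator (absolutely convergent, and independent of
the basis, if `T` is of trace class). -/
def trace (T : L2 →L[ℂ] L2) : ℂ :=
  ∑' i, ⟪(basis i : L2), T (basis i)⟫_ℂ

/-! ### The logarithmic perturbation determinant -/

/-- `Λ = (∂ + iκ²)^{-1/2} κ q (∂ - iκ²)^{-1/2}`. -/
def Lam (κ : ℂ) (q : ℝ → ℂ) : L2 →L[ℂ] L2 :=
  rsqrtD (I * κ ^ 2) ∘L (κ • mulOp q) ∘L rsqrtD (-(I * κ ^ 2))

/-- `Γ = (∂ - iκ²)^{-1/2} κ r (∂ + iκ²)^{-1/2}`. -/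
def Gam (κ : ℂ) (r : ℝ → ℂ) : L2 →L[ℂ] L2 :=
  rsqrtD (-(I * κ ^ 2)) ∘L (κ • mulOp r) ∘L rsqrtD (I * κ ^ 2)

/-- `A_m(κ; q, r) = - sgn(iκ²) (1/m) tr((ΛΓ)^m)`, for `m ≥ 1` and real `iκ² ≠ 0`. -/
def Aterm (κ : ℂ) (q r : ℝ → ℂ) (m : ℕ) : ℂ :=
  -(Real.sign (I * κ ^ 2).re : ℂ) * (1 / (m : ℂ)) * trace ((Lam κ q ∘L Gam κ r) ^ m)

/-- `A(κ; q, r) = ∑_{m ≥ 1} A_m(κ; q, r)`. -/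
def A (κ : ℂ) (q r : ℝ → ℂ) : ℂ :=
  ∑' m : ℕ, Aterm κ q r (m + 1)

/-! ### Mass, Hamiltonian, energy -/

/-- `M = ∫ q r dx`. -/
def mass (q r : ℝ → ℂ) : ℂ := ∫ x, q x * r x

/-- `H_DNLS = ∫ -i q r' + (1/2) q² r² dx`. -/
def hamiltonian (q r : ℝ → ℂ) : ℂ :=
  ∫ x, (-I * q x * deriv r x + (1 / 2) * q x ^ 2 * r x ^ 2)

/-- `E_DNLS = ∫ q' r' - (3/2) i q² r r' + (1/2) q³ r³ dx`. -/
def energy (q r : ℝ → ℂ) : ℂ :=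
  ∫ x, (deriv q x * deriv r x - (3 / 2) * I * q x ^ 2 * r x * deriv r x
    + (1 / 2) * q x ^ 3 * r x ^ 3)

/-! ### The Sobolev norm -/

/-- The unitary Fourier transform `q̂(ξ) = (2π)^{-1/2} ∫ e^{-iξx} q(x) dx`. -/
def hat (q : ℝ → ℂ) (ξ : ℝ) : ℂ :=
  ((1 / Real.sqrt (2 * Real.pi) : ℝ) : ℂ) * ∫ x : ℝ, Complex.exp (-I * ξ * x) * q x

/-- `‖q‖_{H^s} = (∫ (4 + ξ²)^s |q̂(ξ)|² dξ)^{1/2}`; for `s = 0` this is the `L²` norm. -/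
def sobolevNorm (s : ℝ) (q : 𝓢(ℝ, ℂ)) : ℝ :=
  Real.sqrt (∫ ξ : ℝ, (4 + ξ ^ 2) ^ s * ‖hat q ξ‖ ^ 2)

/-- `r = - q̄`. -/
def negConj (q : 𝓢(ℝ, ℂ)) : ℝ → ℂ := fun x => -(starRingEnd ℂ) (q x)

/-- The spectral parameters under consideration: complex `κ` with `iκ² ∈ ℝ`. -/
def spectralSet : Set ℂ := {κ : ℂ | (I * κ ^ 2).im = 0}

end DNLS

end

noncomputable section

namespace DNLS

theorem opMul_apply (A B : L2 →L[ℂ] L2) (f : L2) : (A * B) f = A (B f) := rfl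

/-! ### Bounded symbols, multiplication operators and Fourier multipliers -/

/-- A measurable function with a global bound. -/
def BddMeas (a : ℝ → ℂ) : Prop := Measurable a ∧ ∃ C, ∀ x, ‖a x‖ ≤ C

theorem BddMeas.memLp {a : ℝ → ℂ} (h : BddMeas a) : MemLp a ∞ (volume : Measure ℝ) := by
  obtain ⟨hm, C, hC⟩ := h
  exact memLp_top_of_bound hm.aestronglyMeasurable C (Eventually.of_forall hC)

theorem BddMeas.mul {a b : ℝ → ℂ} (ha : BddMeas a) (hb : BddMeas b) :
    BddMeas (fun x => a x * b x) := by
  obtain ⟨ha, C, hC⟩ := ha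
  obtain ⟨hb, D, hD⟩ := hb
  refine ⟨ha.mul hb, C * D, fun x => ?_⟩
  rw [norm_mul]
  exact mul_le_mul (hC x) (hD x) (norm_nonneg _) ((norm_nonneg _).trans (hC x))

theorem BddMeas.add {a b : ℝ → ℂ} (ha : BddMeas a) (hb : BddMeas b) :
    BddMeas (fun x => a x + b x) := by
  obtain ⟨ha, C, hC⟩ := ha
  obtain ⟨hb, D, hD⟩ := hb
  exact ⟨ha.add hb, C + D, fun x => (norm_add_le _ _).trans (add_le_add (hC x) (hD x))⟩

theorem BddMeas.conj {a : ℝ → ℂ} (ha : BddMeas a) :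
    BddMeas (fun x => (starRingEnd ℂ) (a x)) := by
  obtain ⟨ha, C, hC⟩ := ha
  refine ⟨continuous_conj.measurable.comp ha, C, fun x => ?_⟩
  rw [RCLike.norm_conj]
  exact hC x

theorem BddMeas.comp_scale {m : ℝ → ℂ} (hm : BddMeas m) :
    BddMeas (fun η : ℝ => m (2 * Real.pi * η)) := by
  obtain ⟨hm, C, hC⟩ := hm
  exact ⟨hm.comp (by fun_prop), C, fun x => hC _⟩

theorem bddMeas_schwartz (f : 𝓢(ℝ, ℂ)) : BddMeas f :=
  ⟨f.continuous.measurable, _, fun x => SchwartzMap.norm_le_seminorm ℂ f x⟩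

theorem mulOp_mul {a b : ℝ → ℂ} (ha : BddMeas a) (hb : BddMeas b) :
    mulOp a * mulOp b = mulOp (fun x => a x * b x) := by
  ext1 f
  apply Lp.ext
  filter_upwards [mulOp_apply_ae ha.memLp (mulOp b f), mulOp_apply_ae hb.memLp f,
    mulOp_apply_ae (ha.mul hb).memLp f] with x h1 h2 h3
  rw [opMul_apply, h1, h2, h3, mul_assoc]

theorem mulOp_add {a b : ℝ → ℂ} (ha : BddMeas a) (hb : BddMeas b) :
    mulOp (fun x => a x + b x) = mulOp a + mulOp b := by
  ext1 f
  apply Lp.ext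
  filter_upwards [mulOp_apply_ae ha.memLp f, mulOp_apply_ae hb.memLp f,
    mulOp_apply_ae (ha.add hb).memLp f, Lp.coeFn_add (mulOp a f) (mulOp b f)] with x h1 h2 h3 h4
  rw [_root_.add_apply, h4, Pi.add_apply, h1, h2, h3, add_mul]

theorem norm_mulOp_le {a : ℝ → ℂ} (ha : Measurable a) {C : ℝ} (hC : ∀ x, ‖a x‖ ≤ C) :
    ‖mulOp a‖ ≤ C := by
  refine ContinuousLinearMap.opNorm_le_bound _ ((norm_nonneg _).trans (hC 0)) fun f => ?_
  apply Lp.norm_le_mul_norm_of_ae_le_mul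
  have hb : BddMeas a := ⟨ha, C, hC⟩
  filter_upwards [mulOp_apply_ae hb.memLp f] with x h1
  rw [h1, norm_mul]
  exact mul_le_mul_of_nonneg_right (hC x) (norm_nonneg _)

theorem adjoint_mulOp {a : ℝ → ℂ} (ha : BddMeas a) :
    ContinuousLinearMap.adjoint (mulOp a) = mulOp (fun x => (starRingEnd ℂ) (a x)) := by
  symm
  rw [ContinuousLinearMap.eq_adjoint_iff]
  intro f g
  rw [L2.inner_def, L2.inner_def]
  apply integral_congr_ae
  filter_upwards [mulOp_apply_ae ha.memLp g, mulOp_apply_ae ha.conj.memLp f] with x h1 h2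
  rw [h1, h2]
  simp only [RCLike.inner_apply, map_mul, RCLike.conj_conj]
  ring

/-- The Fourier transform on `L²(ℝ)`. -/
abbrev FT : L2 ≃ₗᵢ[ℂ] L2 := Lp.fourierTransformₗᵢ ℝ ℂ

theorem FT_fourierMult (m : ℝ → ℂ) (f : L2) :
    FT (fourierMult m f) = mulOp (fun η : ℝ => m (2 * Real.pi * η)) (FT f) := by
  simp [fourierMult]

theorem FT_fourierMult_ae {m : ℝ → ℂ} (hm : BddMeas m) (f : L2) :
    FT (fourierMult m f) =ᵐ[volume] fun η : ℝ => m (2 * Real.pi * η) * FT f η := by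
  rw [FT_fourierMult]
  exact mulOp_apply_ae hm.comp_scale.memLp _

theorem fourierMult_mul {m n : ℝ → ℂ} (hm : BddMeas m) (hn : BddMeas n) :
    fourierMult m * fourierMult n = fourierMult (fun x => m x * n x) := by
  ext1 f
  apply FT.injective
  rw [opMul_apply, FT_fourierMult, FT_fourierMult, FT_fourierMult,
    ← mulOp_mul hm.comp_scale hn.comp_scale, opMul_apply]

theorem fourierMult_add {m n : ℝ → ℂ} (hm : BddMeas m) (hn : BddMeas n) :
    fourierMult (fun x => m x + n x) = fourierMult m + fourierMult n := by
  ext1 f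
  apply FT.injective
  rw [_root_.add_apply, map_add, FT_fourierMult, FT_fourierMult, FT_fourierMult,
    mulOp_add hm.comp_scale hn.comp_scale, _root_.add_apply]

theorem fourierMult_one : fourierMult (fun _ => 1) = 1 := by
  ext1 f
  apply FT.injective
  apply Lp.ext
  filter_upwards [FT_fourierMult_ae ⟨measurable_const, 1, fun _ => norm_one.le⟩ f] with x hx
  rw [hx, one_mul]
  rfl

theorem norm_fourierMult_le {m : ℝ → ℂ} (hm : Measurable m) {C : ℝ} (hC : ∀ x, ‖m x‖ ≤ C) :
    ‖fourierMult m‖ ≤ C := by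
  refine ContinuousLinearMap.opNorm_le_bound _ ((norm_nonneg _).trans (hC 0)) fun f => ?_
  rw [← FT.norm_map, FT_fourierMult, ← FT.norm_map f]
  have hm' : Measurable (fun η : ℝ => m (2 * Real.pi * η)) := hm.comp (by fun_prop)
  exact ContinuousLinearMap.le_of_opNorm_le _ (norm_mulOp_le hm' fun x => hC _) _

theorem adjoint_fourierMult {m : ℝ → ℂ} (hm : BddMeas m) :
    ContinuousLinearMap.adjoint (fourierMult m) =
      fourierMult (fun x => (starRingEnd ℂ) (m x)) := by
  symm
  rw [ContinuousLinearMap.eq_adjoint_iff]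
  intro f g
  rw [← FT.inner_map_map, FT_fourierMult, ← adjoint_mulOp hm.comp_scale,
    ContinuousLinearMap.adjoint_inner_left, ← FT_fourierMult, FT.inner_map_map]

/-! ### Schwartz functions -/

/-- Multiplication of Schwartz functions. -/
def schwartzMul (f g : 𝓢(ℝ, ℂ)) : 𝓢(ℝ, ℂ) := SchwartzMap.pairing (ContinuousLinearMap.mul ℂ ℂ) f g

theorem schwartzMul_apply (f g : 𝓢(ℝ, ℂ)) (x : ℝ) : schwartzMul f g x = f x * g x := by
  simp [schwartzMul]

/-- The derivative of a Schwartz function. -/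
def sderiv (f : 𝓢(ℝ, ℂ)) : 𝓢(ℝ, ℂ) := SchwartzMap.derivCLM ℂ ℂ f

theorem sderiv_apply (f : 𝓢(ℝ, ℂ)) (x : ℝ) : sderiv f x = deriv f x := rfl

theorem sderiv_schwartzMul (f g : 𝓢(ℝ, ℂ)) :
    sderiv (schwartzMul f g) = schwartzMul (sderiv f) g + schwartzMul f (sderiv g) := by
  ext x
  have h1 : (schwartzMul f g : ℝ → ℂ) = fun x => f x * g x := funext (schwartzMul_apply f g)
  rw [sderiv_apply, h1, deriv_fun_mul f.differentiableAt g.differentiableAt]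
  simp [schwartzMul_apply, sderiv_apply]

/-- Complex conjugation of Schwartz functions. -/
def sconj (f : 𝓢(ℝ, ℂ)) : 𝓢(ℝ, ℂ) :=
  SchwartzMap.postcompCLM (𝕜 := ℝ) (conjCLE : ℂ →L[ℝ] ℂ) f

theorem sconj_apply (f : 𝓢(ℝ, ℂ)) (x : ℝ) : sconj f x = (starRingEnd ℂ) (f x) := by
  simp [sconj]

theorem mulOp_toLp (f g : 𝓢(ℝ, ℂ)) : mulOp f (g.toLp 2) = (schwartzMul f g).toLp 2 := by
  apply Lp.ext
  filter_upwards [mulOp_apply_ae (bddMeas_schwartz f).memLp (g.toLp 2), g.coeFn_toLp 2,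
    (schwartzMul f g).coeFn_toLp 2] with x h1 h2 h3
  rw [h1, h2, h3, schwartzMul_apply]

theorem FT_toLp (f : 𝓢(ℝ, ℂ)) : FT (f.toLp 2) = (𝓕 f).toLp 2 := SchwartzMap.toLp_fourier_eq f

theorem mulOp_schwartzMul (f g : 𝓢(ℝ, ℂ)) : mulOp (schwartzMul f g) = mulOp f * mulOp g := by
  rw [mulOp_mul (bddMeas_schwartz f) (bddMeas_schwartz g)]
  congr 1

/-! ### The resolvent of `∂` and its commutator with multiplication operators -/

/-- The symbol of `(∂ + c)⁻¹`. -/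
def res (c : ℝ) (ξ : ℝ) : ℂ := (I * ξ + c)⁻¹

theorem res_den_ne_zero {c : ℝ} (hc : c ≠ 0) (ξ : ℝ) : I * (ξ : ℂ) + c ≠ 0 := by
  intro h
  have := congrArg Complex.re h
  simp at this
  exact hc this

theorem normSq_res_den (c ξ : ℝ) : Complex.normSq (I * (ξ : ℂ) + c) = ξ ^ 2 + c ^ 2 := by
  simp [Complex.normSq_apply]
  ring

theorem measurable_res (c : ℝ) : Measurable (res c) := by
  unfold res
  fun_prop

theorem norm_res_le {c : ℝ} (hc : c ≠ 0) (ξ : ℝ) : ‖res c ξ‖ ≤ |c|⁻¹ := by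
  rw [res, norm_inv]
  apply inv_anti₀ (abs_pos.mpr hc)
  have := Complex.abs_re_le_norm (I * (ξ : ℂ) + c)
  simpa using this

theorem bddMeas_res {c : ℝ} (hc : c ≠ 0) : BddMeas (res c) :=
  ⟨measurable_res c, _, norm_res_le hc⟩

/-- The resolvent `(∂ + c)⁻¹`. -/
def Res (c : ℝ) : L2 →L[ℂ] L2 := fourierMult (res c)

theorem norm_Res_le {c : ℝ} (hc : c ≠ 0) : ‖Res c‖ ≤ |c|⁻¹ :=
  norm_fourierMult_le (measurable_res c) (norm_res_le hc)

theorem hasTemperateGrowth_res {c : ℝ} (hc : c ≠ 0) :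
    Function.HasTemperateGrowth (fun η : ℝ => res c (2 * Real.pi * η)) := by
  have h0 : (fun η : ℝ => res c (2 * Real.pi * η)) = fun η : ℝ =>
      ((1 / c ^ 2 : ℝ) : ℂ) * (((1 + ‖(2 * Real.pi / c) * η‖ ^ 2) ^ (-1 : ℝ) : ℝ) : ℂ) *
        ((c : ℂ) - I * ((2 * Real.pi * η : ℝ) : ℂ)) := by
    ext η
    have h1 := res_den_ne_zero hc (2 * Real.pi * η)
    have h2 : (1 + ‖(2 * Real.pi / c) * η‖ ^ 2) = ((2 * Real.pi * η) ^ 2 + c ^ 2) / c ^ 2 := by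
      rw [Real.norm_eq_abs, sq_abs]
      field_simp
      ring
    have h3 : (((2 * Real.pi * η) ^ 2 + c ^ 2 : ℝ) : ℂ) ≠ 0 := by
      norm_cast
      positivity
    rw [h2, Real.rpow_neg_one, res, inv_div]
    have h4 : (c : ℂ) ≠ 0 := by exact_mod_cast hc
    symm
    apply eq_inv_of_mul_eq_one_left
    generalize 2 * Real.pi * η = y at *
    push_cast at h3 ⊢
    have h5 : ((c : ℂ) - I * y) * (I * y + c) = (y : ℂ) ^ 2 + (c : ℂ) ^ 2 := by
      linear_combination (-(y : ℂ) ^ 2) * I_sq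
    rw [mul_assoc, h5]
    field_simp
  rw [h0]
  have h5 : Function.HasTemperateGrowth
      (fun η : ℝ => (1 + ‖(2 * Real.pi / c) * η‖ ^ 2) ^ (-1 : ℝ)) := by
    have := (Function.hasTemperateGrowth_one_add_norm_sq_rpow ℝ (-1)).comp
      ((2 * Real.pi / c) • ContinuousLinearMap.id ℝ ℝ).hasTemperateGrowth
    exact this
  have h6 : Function.HasTemperateGrowth
      (fun η : ℝ => (((1 + ‖(2 * Real.pi / c) * η‖ ^ 2) ^ (-1 : ℝ) : ℝ) : ℂ)) :=
    Function.Complex.hasTemperateGrowth_ofReal.comp h5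
  have h7 : Function.HasTemperateGrowth (fun η : ℝ => ((2 * Real.pi * η : ℝ) : ℂ)) :=
    Function.Complex.hasTemperateGrowth_ofReal.comp
      ((2 * Real.pi) • ContinuousLinearMap.id ℝ ℝ).hasTemperateGrowth
  exact ((Function.HasTemperateGrowth.const _).mul h6).mul
    ((Function.HasTemperateGrowth.const _).sub ((Function.HasTemperateGrowth.const _).mul h7))

theorem fourier_sderiv (f : 𝓢(ℝ, ℂ)) (η : ℝ) :
    (𝓕 (sderiv f)) η = I * ((2 * Real.pi * η : ℝ) : ℂ) * (𝓕 f) η := by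
  rw [SchwartzMap.fourier_coe, SchwartzMap.fourier_coe]
  have h : (sderiv f : ℝ → ℂ) = deriv f := rfl
  rw [h, Real.fourier_deriv f.integrable f.differentiable (sderiv f).integrable]
  simp only [smul_eq_mul]
  push_cast
  ring

theorem Res_toLp {c : ℝ} (hc : c ≠ 0) (h : 𝓢(ℝ, ℂ)) :
    Res c ((sderiv h + (c : ℂ) • h).toLp 2) = h.toLp 2 := by
  apply FT.injective
  rw [FT_toLp]
  apply Lp.ext
  have h0 := FT_fourierMult_ae (bddMeas_res hc) ((sderiv h + (c : ℂ) • h).toLp 2)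
  rw [FT_toLp] at h0
  filter_upwards [h0, (𝓕 h).coeFn_toLp 2, (𝓕 (sderiv h + (c : ℂ) • h)).coeFn_toLp 2]
    with x h1 h2 h3
  rw [Res, h1, h2, h3, FourierTransform.fourier_add, FourierTransform.fourier_smul]
  simp only [_root_.add_apply, _root_.smul_apply, fourier_sderiv, smul_eq_mul]
  rw [← add_mul, ← mul_assoc, res, inv_mul_cancel₀ (res_den_ne_zero hc _), one_mul]

theorem exists_sderiv_add_smul_eq {c : ℝ} (hc : c ≠ 0) (g : 𝓢(ℝ, ℂ)) :
    ∃ h : 𝓢(ℝ, ℂ), sderiv h + (c : ℂ) • h = g := by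
  refine ⟨SchwartzMap.fourierMultiplierCLM ℂ (fun η : ℝ => res c (2 * Real.pi * η)) g, ?_⟩
  apply (FourierTransform.fourierEquiv ℂ 𝓢(ℝ, ℂ)).injective
  change 𝓕 (_ : 𝓢(ℝ, ℂ)) = 𝓕 g
  rw [FourierTransform.fourier_add, FourierTransform.fourier_smul]
  ext η
  simp only [_root_.add_apply, _root_.smul_apply, fourier_sderiv, smul_eq_mul]
  rw [SchwartzMap.fourierMultiplierCLM_apply, FourierTransform.fourier_fourierInv_eq,
    SchwartzMap.smulLeftCLM_apply_apply (hasTemperateGrowth_res hc), smul_eq_mul, ← add_mul,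
    ← mul_assoc, res, mul_inv_cancel₀ (res_den_ne_zero hc _), one_mul]

/-- The commutator identity `f R = R f + R f' R` for `R = (∂ + c)⁻¹`. -/
theorem mulOp_mul_Res {c : ℝ} (hc : c ≠ 0) (f : 𝓢(ℝ, ℂ)) :
    mulOp f * Res c = Res c * mulOp f + Res c * mulOp (sderiv f) * Res c := by
  apply ContinuousLinearMap.coeFn_injective
  refine (SchwartzMap.denseRange_toLpCLM (p := 2) (F := ℂ) (μ := (volume : Measure ℝ))
    ENNReal.ofNat_ne_top).equalizer (ContinuousLinearMap.continuous _)
    (ContinuousLinearMap.continuous _) ?_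
  funext g
  obtain ⟨h, rfl⟩ := exists_sderiv_add_smul_eq hc g
  simp only [Function.comp_apply, SchwartzMap.toLpCLM_apply, _root_.add_apply,
    opMul_apply]
  rw [Res_toLp hc, mulOp_toLp, mulOp_toLp, mulOp_toLp, ← map_add, ← Res_toLp hc (schwartzMul f h)]
  congr 1
  rw [← SchwartzMap.toLpCLM_apply (𝕜 := ℂ), ← SchwartzMap.toLpCLM_apply (𝕜 := ℂ),
    ← SchwartzMap.toLpCLM_apply (𝕜 := ℂ), ← map_add]
  congr 1
  rw [sderiv_schwartzMul]
  ext x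
  simp only [_root_.add_apply, _root_.smul_apply, schwartzMul_apply, smul_eq_mul]
  ring

/-! ### Hilbert–Schmidt operators -/

theorem hasSum_norm_inner_sq (v : L2) :
    HasSum (fun i => ‖⟪(basis i : L2), v⟫_ℂ‖ ^ 2) (‖v‖ ^ 2) := by
  have h := Complex.reCLM.hasSum (basis.hasSum_inner_mul_inner v v)
  have h1 : Complex.reCLM ⟪v, v⟫_ℂ = ‖v‖ ^ 2 := by
    rw [inner_self_eq_norm_sq_to_K, Complex.reCLM_apply]
    norm_cast
  rw [h1] at h
  have h2 : (fun i => ‖⟪(basis i : L2), v⟫_ℂ‖ ^ 2) =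
      fun i => Complex.reCLM (⟪v, (basis i : L2)⟫_ℂ * ⟪(basis i : L2), v⟫_ℂ) := by
    ext i
    rw [← inner_conj_symm v, RCLike.conj_mul, Complex.reCLM_apply]
    norm_cast
  rwa [h2]

/-- The square of the Hilbert–Schmidt norm, as an extended nonnegative real. -/
def hsq (T : L2 →L[ℂ] L2) : ℝ≥0∞ := ∑' i, ‖T (basis i)‖ₑ ^ 2

theorem tsum_enorm_inner_sq (v : L2) :
    ∑' i, ‖⟪(basis i : L2), v⟫_ℂ‖ₑ ^ 2 = ‖v‖ₑ ^ 2 := by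
  have h := hasSum_norm_inner_sq v
  have h1 := ENNReal.ofReal_tsum_of_nonneg (fun i => sq_nonneg _) h.summable
  rw [h.tsum_eq] at h1
  rw [← ofReal_norm v, ← ENNReal.ofReal_pow (norm_nonneg _), h1]
  congr 1
  ext i
  rw [← ofReal_norm, ENNReal.ofReal_pow (norm_nonneg _)]

theorem isHilbertSchmidt_iff {T : L2 →L[ℂ] L2} : IsHilbertSchmidt T ↔ hsq T ≠ ∞ := by
  constructor
  · intro h
    have h1 := ENNReal.ofReal_tsum_of_nonneg (fun i => sq_nonneg _) h
    have h2 : hsq T = ENNReal.ofReal (∑' i, ‖T (basis i)‖ ^ 2) := by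
      rw [h1, hsq]
      congr 1
      ext i
      rw [← ofReal_norm, ENNReal.ofReal_pow (norm_nonneg _)]
    rw [h2]
    exact ENNReal.ofReal_ne_top
  · intro h
    refine (ENNReal.summable_toReal h).congr fun i => ?_
    rw [ENNReal.toReal_pow, toReal_enorm]

theorem hsq_eq_tsum_tsum (T : L2 →L[ℂ] L2) :
    hsq T = ∑' i, ∑' j, ‖⟪(basis j : L2), T (basis i)⟫_ℂ‖ₑ ^ 2 := by
  rw [hsq]
  congr 1
  ext i
  rw [tsum_enorm_inner_sq]

theorem hsq_adjoint (T : L2 →L[ℂ] L2) : hsq (ContinuousLinearMap.adjoint T) = hsq T := by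
  rw [hsq_eq_tsum_tsum, hsq_eq_tsum_tsum, ENNReal.tsum_comm]
  congr 1
  ext i
  congr 1
  ext j
  rw [ContinuousLinearMap.adjoint_inner_right, ← inner_conj_symm, RCLike.enorm_conj]

theorem hsq_mul_left (X T : L2 →L[ℂ] L2) : hsq (X * T) ≤ ‖X‖ₑ ^ 2 * hsq T := by
  rw [hsq, hsq, ← ENNReal.tsum_mul_left]
  refine ENNReal.tsum_le_tsum fun i => ?_
  rw [← mul_pow]
  exact pow_le_pow_left' (X.le_opENorm _) 2

theorem hsq_mul_right (T X : L2 →L[ℂ] L2) : hsq (T * X) ≤ ‖X‖ₑ ^ 2 * hsq T := by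
  rw [← hsq_adjoint, ← hsq_adjoint T]
  have h : ContinuousLinearMap.adjoint (T * X) =
      ContinuousLinearMap.adjoint X * ContinuousLinearMap.adjoint T :=
    ContinuousLinearMap.adjoint_comp T X
  rw [h]
  refine (hsq_mul_left _ _).trans (le_of_eq ?_)
  congr 2
  rw [← ofReal_norm, ← ofReal_norm, LinearIsometryEquiv.norm_map]

theorem hsq_add (S T : L2 →L[ℂ] L2) : hsq (S + T) ≤ 2 * (hsq S + hsq T) := by
  rw [hsq, hsq, hsq, ← ENNReal.tsum_add, ← ENNReal.tsum_mul_left]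
  refine ENNReal.tsum_le_tsum fun i => ?_
  have h1 : ‖(S + T) (basis i)‖ ^ 2 ≤ 2 * (‖S (basis i)‖ ^ 2 + ‖T (basis i)‖ ^ 2) := by
    have := norm_add_le (S (basis i)) (T (basis i))
    rw [_root_.add_apply]
    nlinarith [sq_nonneg (‖S (basis i)‖ - ‖T (basis i)‖),
      norm_nonneg (S (basis i) + T (basis i))]
  simp only [← ofReal_norm, ← ENNReal.ofReal_pow (norm_nonneg _)]
  rw [← ENNReal.ofReal_add (sq_nonneg _) (sq_nonneg _)]
  refine (ENNReal.ofReal_le_ofReal h1).trans (le_of_eq ?_)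
  rw [ENNReal.ofReal_mul (by norm_num), ENNReal.ofReal_ofNat]

theorem enorm_apply_sq_le (T : L2 →L[ℂ] L2) (v : L2) : ‖T v‖ₑ ^ 2 ≤ hsq T * ‖v‖ₑ ^ 2 := by
  rw [← tsum_enorm_inner_sq, ← hsq_adjoint, hsq, ← ENNReal.tsum_mul_right]
  refine ENNReal.tsum_le_tsum fun i => ?_
  rw [← ContinuousLinearMap.adjoint_inner_left, ← mul_pow]
  refine pow_le_pow_left' ?_ 2
  simp only [← ofReal_norm]
  rw [← ENNReal.ofReal_mul (norm_nonneg _)]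
  exact ENNReal.ofReal_le_ofReal (norm_inner_le_norm _ _)

/-- The Hilbert–Schmidt norm (and `0` if the operator is not Hilbert–Schmidt). -/
def hs (T : L2 →L[ℂ] L2) : ℝ := Real.sqrt (hsq T).toReal

theorem hs_nonneg (T : L2 →L[ℂ] L2) : 0 ≤ hs T := Real.sqrt_nonneg _

theorem hs_sq (T : L2 →L[ℂ] L2) : hs T ^ 2 = (hsq T).toReal :=
  Real.sq_sqrt ENNReal.toReal_nonneg

theorem hs_sq_eq_tsum (T : L2 →L[ℂ] L2) : hs T ^ 2 = ∑' i, ‖T (basis i)‖ ^ 2 := by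
  rw [hs_sq, hsq, ENNReal.tsum_toReal_eq fun i => by finiteness]
  simp

theorem hs_adjoint (T : L2 →L[ℂ] L2) : hs (ContinuousLinearMap.adjoint T) = hs T := by
  rw [hs, hsq_adjoint, hs]

theorem IsHilbertSchmidt.adjoint {T : L2 →L[ℂ] L2} (h : IsHilbertSchmidt T) :
    IsHilbertSchmidt (ContinuousLinearMap.adjoint T) := by
  rw [isHilbertSchmidt_iff, hsq_adjoint]
  exact isHilbertSchmidt_iff.mp h

theorem hsBound_of_hsq_le {S T X : L2 →L[ℂ] L2} (h : IsHilbertSchmidt T)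
    (hle : hsq S ≤ ‖X‖ₑ ^ 2 * hsq T) : IsHilbertSchmidt S ∧ hs S ≤ ‖X‖ * hs T := by
  have hT := isHilbertSchmidt_iff.mp h
  have hfin : ‖X‖ₑ ^ 2 * hsq T ≠ ∞ := ENNReal.mul_ne_top (by finiteness) hT
  refine ⟨isHilbertSchmidt_iff.mpr (ne_top_of_le_ne_top hfin hle), ?_⟩
  apply abs_le_of_sq_le_sq' _ (mul_nonneg (norm_nonneg _) (hs_nonneg _)) |>.2
  rw [mul_pow, hs_sq, hs_sq]
  refine (ENNReal.toReal_mono hfin hle).trans (le_of_eq ?_)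
  rw [ENNReal.toReal_mul, ENNReal.toReal_pow, toReal_enorm]

theorem IsHilbertSchmidt.mul_left {T : L2 →L[ℂ] L2} (h : IsHilbertSchmidt T)
    (X : L2 →L[ℂ] L2) : IsHilbertSchmidt (X * T) :=
  (hsBound_of_hsq_le h (hsq_mul_left X T)).1

theorem IsHilbertSchmidt.mul_right {T : L2 →L[ℂ] L2} (h : IsHilbertSchmidt T)
    (X : L2 →L[ℂ] L2) : IsHilbertSchmidt (T * X) :=
  (hsBound_of_hsq_le h (hsq_mul_right T X)).1

theorem hs_mul_left {T : L2 →L[ℂ] L2} (h : IsHilbertSchmidt T) (X : L2 →L[ℂ] L2) :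
    hs (X * T) ≤ ‖X‖ * hs T :=
  (hsBound_of_hsq_le h (hsq_mul_left X T)).2

theorem hs_mul_right {T : L2 →L[ℂ] L2} (h : IsHilbertSchmidt T) (X : L2 →L[ℂ] L2) :
    hs (T * X) ≤ ‖X‖ * hs T :=
  (hsBound_of_hsq_le h (hsq_mul_right T X)).2

theorem IsHilbertSchmidt.smul {T : L2 →L[ℂ] L2} (h : IsHilbertSchmidt T) (z : ℂ) :
    IsHilbertSchmidt (z • T) := by
  simpa using h.mul_left (z • 1)

theorem IsHilbertSchmidt.add {S T : L2 →L[ℂ] L2} (hS : IsHilbertSchmidt S)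
    (hT : IsHilbertSchmidt T) : IsHilbertSchmidt (S + T) := by
  rw [isHilbertSchmidt_iff] at *
  exact ne_top_of_le_ne_top (by finiteness) (hsq_add S T)

theorem hs_add {S T : L2 →L[ℂ] L2} (hS : IsHilbertSchmidt S) (hT : IsHilbertSchmidt T) :
    hs (S + T) ≤ 2 * (hs S + hs T) := by
  rw [isHilbertSchmidt_iff] at *
  have h := ENNReal.toReal_mono (by finiteness) (hsq_add S T)
  rw [ENNReal.toReal_mul, ENNReal.toReal_add hS hT, ← hs_sq, ← hs_sq, ← hs_sq] at h
  have h0 := hs_nonneg S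
  have h1 := hs_nonneg T
  simp only [ENNReal.toReal_ofNat] at h
  apply abs_le_of_sq_le_sq' _ (by positivity) |>.2
  nlinarith [mul_nonneg h0 h1]

theorem norm_le_hs {T : L2 →L[ℂ] L2} (h : IsHilbertSchmidt T) : ‖T‖ ≤ hs T := by
  refine ContinuousLinearMap.opNorm_le_bound _ (hs_nonneg T) fun v => ?_
  apply abs_le_of_sq_le_sq' _ (mul_nonneg (hs_nonneg _) (norm_nonneg _)) |>.2
  have hT := isHilbertSchmidt_iff.mp h
  have := ENNReal.toReal_mono (ENNReal.mul_ne_top hT (by finiteness)) (enorm_apply_sq_le T v)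
  rw [mul_pow, hs_sq]
  simpa using this

/-! ### The trace -/

/-- The series that defines the trace converges. -/
def TraceSummable (T : L2 →L[ℂ] L2) : Prop :=
  Summable fun i => ⟪(basis i : L2), T (basis i)⟫_ℂ

theorem trace_add {S T : L2 →L[ℂ] L2} (hS : TraceSummable S) (hT : TraceSummable T) :
    trace (S + T) = trace S + trace T := by
  rw [trace, trace, trace, ← Summable.tsum_add hS hT]
  congr 1
  ext i
  rw [_root_.add_apply, inner_add_right]

theorem trace_smul (z : ℂ) (T : L2 →L[ℂ] L2) : trace (z • T) = z * trace T := by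
  rw [trace, trace, ← tsum_mul_left]
  congr 1
  ext i
  rw [_root_.smul_apply, inner_smul_right]

theorem summable_norm_trace_mul {A B : L2 →L[ℂ] L2} (hA : IsHilbertSchmidt A)
    (hB : IsHilbertSchmidt B) :
    Summable (fun i => ‖⟪(basis i : L2), (A * B) (basis i)⟫_ℂ‖) ∧
      ∑' i, ‖⟪(basis i : L2), (A * B) (basis i)⟫_ℂ‖ ≤ hs A * hs B := by
  have hle : ∀ i, ‖⟪(basis i : L2), (A * B) (basis i)⟫_ℂ‖ ≤
      ‖ContinuousLinearMap.adjoint A (basis i)‖ * ‖B (basis i)‖ := by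
    intro i
    rw [opMul_apply, ← ContinuousLinearMap.adjoint_inner_left]
    exact norm_inner_le_norm _ _
  have h1 := hA.adjoint
  have h2 := Real.summable_and_inner_le_Lp_mul_Lq_tsum_of_nonneg Real.HolderConjugate.two_two
    (f := fun i => ‖ContinuousLinearMap.adjoint A (basis i)‖) (g := fun i => ‖B (basis i)‖)
    (fun i => norm_nonneg _) (fun i => norm_nonneg _)
    (by simpa using! h1) (by simpa using! hB)
  have hs1 := Summable.of_nonneg_of_le (fun i => norm_nonneg _) hle h2.1
  refine ⟨hs1, (hs1.tsum_le_tsum hle h2.1).trans (h2.2.trans (le_of_eq ?_))⟩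
  rw [← hs_adjoint A]
  simp only [Real.rpow_ofNat, ← hs_sq_eq_tsum, ← Real.sqrt_eq_rpow, Real.sqrt_sq (hs_nonneg _)]

theorem traceSummable_mul {A B : L2 →L[ℂ] L2} (hA : IsHilbertSchmidt A)
    (hB : IsHilbertSchmidt B) : TraceSummable (A * B) :=
  (summable_norm_trace_mul hA hB).1.of_norm

theorem norm_trace_mul_le {A B : L2 →L[ℂ] L2} (hA : IsHilbertSchmidt A)
    (hB : IsHilbertSchmidt B) : ‖trace (A * B)‖ ≤ hs A * hs B :=
  (norm_tsum_le_tsum_norm (summable_norm_trace_mul hA hB).1).trans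
    (summable_norm_trace_mul hA hB).2

theorem summable_matrix_sq {A : L2 →L[ℂ] L2} (hA : IsHilbertSchmidt A) :
    Summable fun p : basisSet × basisSet => ‖⟪(basis p.2 : L2), A (basis p.1)⟫_ℂ‖ ^ 2 := by
  rw [isHilbertSchmidt_iff, hsq_eq_tsum_tsum, ← ENNReal.tsum_prod] at hA
  simpa using ENNReal.summable_toReal hA

theorem trace_mul_comm {A B : L2 →L[ℂ] L2} (hA : IsHilbertSchmidt A)
    (hB : IsHilbertSchmidt B) : trace (A * B) = trace (B * A) := by
  have key : ∀ A B : L2 →L[ℂ] L2, trace (A * B) =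
      ∑' i, ∑' j, ⟪(basis i : L2), A (basis j)⟫_ℂ * ⟪(basis j : L2), B (basis i)⟫_ℂ := by
    intro A B
    rw [trace]
    congr 1
    ext i
    rw [opMul_apply, ← ContinuousLinearMap.adjoint_inner_left, ← basis.tsum_inner_mul_inner]
    simp only [ContinuousLinearMap.adjoint_inner_left]
  rw [key, key, Summable.tsum_comm]
  · refine tsum_congr fun i => tsum_congr fun j => mul_comm _ _
  · have h1 := summable_matrix_sq hA
    have h2 := (summable_matrix_sq hB).comp_injective Prod.swap_injective
    refine Summable.of_norm_bounded (h1.add h2) fun p => ?_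
    simp only [Function.uncurry, norm_mul, Function.comp_apply, Prod.fst_swap, Prod.snd_swap]
    generalize ‖⟪(basis p.2 : L2), A (basis p.1)⟫_ℂ‖ = x
    generalize ‖⟪(basis p.1 : L2), B (basis p.2)⟫_ℂ‖ = y
    nlinarith [sq_nonneg (x - y), sq_nonneg (x + y)]

theorem IsTraceClass.trace_mul_comm {T : L2 →L[ℂ] L2} (h : IsTraceClass T)
    (X : L2 →L[ℂ] L2) : trace (X * T) = trace (T * X) := by
  obtain ⟨A, B, hA, hB, rfl⟩ := h
  change trace (X * (A * B)) = trace (A * B * X)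
  rw [← mul_assoc, DNLS.trace_mul_comm (hA.mul_left X) hB, ← mul_assoc,
    DNLS.trace_mul_comm (hB.mul_right X) hA, mul_assoc]

instance : Countable basisSet := by
  have : Fact ((2 : ℝ≥0∞) ≠ ∞) := ⟨by simp⟩
  refine Pairwise.countable_of_isOpen_disjoint (s := fun i => Metric.ball (basis i : L2) (1 / 2))
    (fun i j hij => ?_) (fun _ => Metric.isOpen_ball) fun i => ⟨basis i, by simp⟩
  apply Metric.ball_disjoint_ball
  have h1 := basis.orthonormal.1 i
  have h2 := basis.orthonormal.1 j
  have h3 := norm_sub_sq (𝕜 := ℂ) (basis i : L2) (basis j)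
  rw [basis.orthonormal.2 hij, h1, h2] at h3
  rw [dist_eq_norm]
  simp at h3
  nlinarith [norm_nonneg ((basis i : L2) - basis j)]

/-! ### Operators with rows in Fourier space -/

theorem enorm_sq_eq_lintegral (f : L2) : ‖f‖ₑ ^ 2 = ∫⁻ x, ‖f x‖ₑ ^ 2 := by
  have h := eLpNorm_nnreal_pow_eq_lintegral (p := 2) (f := f) (μ := (volume : Measure ℝ))
    (by norm_num)
  simpa [Lp.enorm_def] using h

/-- `T` is, on the Fourier side, the integral operator with the rows `k ξ`. -/
def HasRows (T : L2 →L[ℂ] L2) (k : ℝ → L2) : Prop :=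
  ∀ f, FT (T f) =ᵐ[volume] fun ξ => ⟪k ξ, f⟫_ℂ

theorem HasRows.aestronglyMeasurable {T : L2 →L[ℂ] L2} {k : ℝ → L2} (h : HasRows T k) (f : L2) :
    AEStronglyMeasurable (fun ξ => ⟪k ξ, f⟫_ℂ) (volume : Measure ℝ) :=
  (Lp.aestronglyMeasurable (FT (T f))).congr (h f)

theorem HasRows.mul_right {T : L2 →L[ℂ] L2} {k : ℝ → L2} (h : HasRows T k) (X : L2 →L[ℂ] L2) :
    HasRows (T * X) fun ξ => ContinuousLinearMap.adjoint X (k ξ) := by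
  intro f
  filter_upwards [h (X f)] with ξ hξ
  rw [opMul_apply, hξ, ContinuousLinearMap.adjoint_inner_left]

theorem HasRows.fourierMult_mul {T : L2 →L[ℂ] L2} {k : ℝ → L2} (h : HasRows T k) {m : ℝ → ℂ}
    (hm : BddMeas m) :
    HasRows (fourierMult m * T) fun ξ => (starRingEnd ℂ) (m (2 * Real.pi * ξ)) • k ξ := by
  intro f
  filter_upwards [h f, FT_fourierMult_ae hm (T f)] with ξ h1 h2
  rw [opMul_apply, h2, h1, inner_smul_left, Complex.conj_conj]

theorem HasRows.enorm_apply_sq {T : L2 →L[ℂ] L2} {k : ℝ → L2} (h : HasRows T k) (f : L2) :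
    ‖T f‖ₑ ^ 2 = ∫⁻ ξ, ‖⟪k ξ, f⟫_ℂ‖ₑ ^ 2 := by
  have h1 : ‖T f‖ₑ = ‖FT (T f)‖ₑ := by
    rw [← ofReal_norm, ← ofReal_norm, FT.norm_map]
  rw [h1, enorm_sq_eq_lintegral]
  apply lintegral_congr_ae
  filter_upwards [h f] with ξ hξ
  rw [hξ]

theorem HasRows.hsq_eq {T : L2 →L[ℂ] L2} {k : ℝ → L2} (h : HasRows T k) :
    hsq T = ∫⁻ ξ, ‖k ξ‖ₑ ^ 2 := by
  rw [hsq]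
  simp_rw [h.enorm_apply_sq]
  rw [← lintegral_tsum fun i => (h.aestronglyMeasurable _).enorm.pow_const 2]
  congr 1
  ext ξ
  rw [← tsum_enorm_inner_sq]
  congr 1
  ext i
  rw [← inner_conj_symm, RCLike.enorm_conj]

theorem HasRows.trace_mul {A B : L2 →L[ℂ] L2} {l k : ℝ → L2}
    (hl : HasRows (ContinuousLinearMap.adjoint A) l) (hk : HasRows B k)
    (hA : IsHilbertSchmidt A) (hB : IsHilbertSchmidt B) :
    trace (A * B) = ∫ ξ, ⟪k ξ, l ξ⟫_ℂ := by
  have h1 : ∀ i, ⟪(basis i : L2), (A * B) (basis i)⟫_ℂ =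
      ∫ ξ, ⟪k ξ, (basis i : L2)⟫_ℂ * ⟪(basis i : L2), l ξ⟫_ℂ := by
    intro i
    rw [opMul_apply, ← ContinuousLinearMap.adjoint_inner_left, ← FT.inner_map_map, L2.inner_def]
    apply integral_congr_ae
    filter_upwards [hl (basis i), hk (basis i)] with ξ h2 h3
    rw [h2, h3, RCLike.inner_apply, inner_conj_symm]
  rw [trace]
  simp_rw [h1]
  have hm : ∀ i, AEStronglyMeasurable
      (fun ξ => ⟪k ξ, (basis i : L2)⟫_ℂ * ⟪(basis i : L2), l ξ⟫_ℂ) (volume : Measure ℝ) := by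
    intro i
    refine (hk.aestronglyMeasurable _).mul ?_
    refine (continuous_conj.comp_aestronglyMeasurable
      (hl.aestronglyMeasurable (basis i))).congr (Eventually.of_forall fun ξ => ?_)
    simp only [inner_conj_symm]
  rw [← integral_tsum hm]
  · congr 1
    ext ξ
    exact basis.tsum_inner_mul_inner _ _
  · have hA' := isHilbertSchmidt_iff.mp hA.adjoint
    have hB' := isHilbertSchmidt_iff.mp hB
    have h4 : hsq B + hsq (ContinuousLinearMap.adjoint A) ≠ ∞ := by finiteness
    refine ne_top_of_le_ne_top h4 ?_
    rw [hsq, hsq, ← ENNReal.tsum_add]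
    refine ENNReal.tsum_le_tsum fun i => ?_
    rw [hk.enorm_apply_sq, hl.enorm_apply_sq,
      ← lintegral_add_left' ((hk.aestronglyMeasurable _).enorm.pow_const 2)]
    refine lintegral_mono fun ξ => ?_
    have h5 : ‖⟪(basis i : L2), l ξ⟫_ℂ‖ₑ = ‖⟪l ξ, (basis i : L2)⟫_ℂ‖ₑ := by
      rw [← inner_conj_symm, RCLike.enorm_conj]
    rw [enorm_mul, h5]
    generalize ‖⟪l ξ, (basis i : L2)⟫_ℂ‖ₑ = y
    generalize ‖⟪k ξ, (basis i : L2)⟫_ℂ‖ₑ = x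
    rcases le_total x y with h | h
    · exact (mul_le_mul_left h y).trans ((sq y).symm.le.trans le_add_self)
    · exact (mul_le_mul_right h x).trans ((sq x).symm.le.trans le_self_add)

/-! ### The rows of multiplication operators -/

/-- The function `x ↦ conj (g x) e^{2πixξ}`. -/
def waveFun (g : 𝓢(ℝ, ℂ)) (ξ : ℝ) (x : ℝ) : ℂ :=
  (starRingEnd ℂ) (g x) * Complex.exp (2 * Real.pi * I * (x * ξ))

theorem norm_exp_phase (x ξ : ℝ) : ‖Complex.exp (2 * Real.pi * I * (x * ξ))‖ = 1 := by
  have : (2 * Real.pi * I * (x * ξ) : ℂ) = ((2 * Real.pi * (x * ξ) : ℝ) : ℂ) * I := by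
    push_cast
    ring
  rw [this, Complex.norm_exp_ofReal_mul_I]

theorem norm_waveFun (g : 𝓢(ℝ, ℂ)) (ξ x : ℝ) : ‖waveFun g ξ x‖ = ‖g x‖ := by
  rw [waveFun, norm_mul, norm_exp_phase, mul_one, RCLike.norm_conj]

theorem memLp_waveFun (g : 𝓢(ℝ, ℂ)) (ξ : ℝ) : MemLp (waveFun g ξ) 2 (volume : Measure ℝ) := by
  refine (g.memLp 2).of_le ?_ (Eventually.of_forall fun x => (norm_waveFun g ξ x).le)
  have := g.continuous
  have h : Continuous (waveFun g ξ) := by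
    unfold waveFun
    fun_prop
  exact h.aestronglyMeasurable

/-- The element `x ↦ conj (g x) e^{2πixξ}` of `L²(ℝ)`. -/
def wave (g : 𝓢(ℝ, ℂ)) (ξ : ℝ) : L2 := (memLp_waveFun g ξ).toLp _

theorem inner_wave_wave (g h : 𝓢(ℝ, ℂ)) (ξ : ℝ) :
    ⟪wave g ξ, wave h ξ⟫_ℂ = ∫ x, g x * (starRingEnd ℂ) (h x) := by
  rw [L2.inner_def]
  apply integral_congr_ae
  filter_upwards [(memLp_waveFun g ξ).coeFn_toLp, (memLp_waveFun h ξ).coeFn_toLp] with x h1 h2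
  rw [wave, wave, h1, h2, RCLike.inner_apply, waveFun, waveFun, map_mul, Complex.conj_conj]
  have h3 := RCLike.conj_mul (K := ℂ) (Complex.exp (2 * Real.pi * I * (x * ξ)))
  rw [norm_exp_phase] at h3
  push_cast at h3
  linear_combination (g x * (starRingEnd ℂ) (h x)) * h3

theorem enorm_wave (g : 𝓢(ℝ, ℂ)) (ξ : ℝ) : ‖wave g ξ‖ₑ = ‖g.toLp 2 (volume : Measure ℝ)‖ₑ := by
  rw [wave, Lp.enorm_toLp, SchwartzMap.toLp, Lp.enorm_toLp]
  exact eLpNorm_congr_norm_ae (Eventually.of_forall fun x => norm_waveFun g ξ x)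

theorem hasRows_mulOp (g : 𝓢(ℝ, ℂ)) : HasRows (mulOp g) (wave g) := by
  have hS : ∀ h : 𝓢(ℝ, ℂ), FT (mulOp g (h.toLp 2)) =ᵐ[volume]
      fun ξ => ⟪wave g ξ, h.toLp 2⟫_ℂ := by
    intro h
    rw [mulOp_toLp, FT_toLp]
    filter_upwards [(𝓕 (schwartzMul g h)).coeFn_toLp 2] with ξ h1
    rw [h1, L2.inner_def, SchwartzMap.fourier_coe, Real.fourier_eq']
    apply integral_congr_ae
    filter_upwards [(memLp_waveFun g ξ).coeFn_toLp, h.coeFn_toLp 2] with x h2 h3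
    have h5 : ∀ z w : ℂ, ⟪z, w⟫_ℂ = w * (starRingEnd ℂ) z := fun z w => RCLike.inner_apply z w
    rw [wave, h2, h3, h5, waveFun, map_mul, Complex.conj_conj, schwartzMul_apply,
      ← Complex.exp_conj, smul_eq_mul]
    have h4 : (starRingEnd ℂ) (2 * Real.pi * I * (x * ξ)) =
        ((-2 * Real.pi * inner ℝ x ξ : ℝ) : ℂ) * I := by
      have h6 : (starRingEnd ℂ) 2 = 2 := map_ofNat _ 2
      simp [Complex.conj_ofReal, h6]
      ring
    rw [h4]
    ring
  intro f
  obtain ⟨u, hu, hlim⟩ := mem_closure_iff_seq_limit.mp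
    (SchwartzMap.denseRange_toLpCLM (p := 2) (F := ℂ) (μ := (volume : Measure ℝ))
      ENNReal.ofNat_ne_top f)
  have h1 : Tendsto (fun n => FT (mulOp g (u n))) atTop (𝓝 (FT (mulOp g f))) :=
    ((FT.continuous.comp (mulOp g).continuous).tendsto f).comp hlim
  obtain ⟨ns, hns, h2⟩ := (tendstoInMeasure_of_tendsto_Lp h1).exists_seq_tendsto_ae
  have h3 : ∀ n, FT (mulOp g (u n)) =ᵐ[volume] fun ξ => ⟪wave g ξ, u n⟫_ℂ := by
    intro n
    obtain ⟨h, hh⟩ := hu n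
    rw [← hh]
    exact hS h
  filter_upwards [h2, ae_all_iff.mpr h3] with ξ h4 h5
  refine tendsto_nhds_unique h4 ?_
  simp_rw [h5]
  exact ((continuous_const.inner continuous_id).tendsto f).comp (hlim.comp hns.tendsto_atTop)

/-! ### Hilbert–Schmidt norms and traces of products of multiplications and multipliers -/

/-- The square of the `L²` norm of a symbol (with respect to `dξ / 2π`). -/
def symSq (m : ℝ → ℂ) : ℝ≥0∞ := ∫⁻ η : ℝ, ‖m (2 * Real.pi * η)‖ₑ ^ 2

theorem hasRows_sandwich {φ ψ : ℝ → ℂ} (hφ : BddMeas φ) (hψ : BddMeas ψ) (g : 𝓢(ℝ, ℂ)) :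
    HasRows (fourierMult φ * mulOp g * fourierMult ψ) fun ξ =>
      (starRingEnd ℂ) (φ (2 * Real.pi * ξ)) •
        fourierMult (fun x => (starRingEnd ℂ) (ψ x)) (wave g ξ) := by
  have h := ((hasRows_mulOp g).mul_right (fourierMult ψ)).fourierMult_mul hφ
  rw [adjoint_fourierMult hψ] at h
  rwa [mul_assoc]

theorem adjoint_mulOp_schwartz (g : 𝓢(ℝ, ℂ)) :
    ContinuousLinearMap.adjoint (mulOp g) = mulOp (sconj g) := by
  rw [adjoint_mulOp (bddMeas_schwartz g)]
  congr 1

theorem adjoint_opMul (A B : L2 →L[ℂ] L2) : ContinuousLinearMap.adjoint (A * B) =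
    ContinuousLinearMap.adjoint B * ContinuousLinearMap.adjoint A :=
  ContinuousLinearMap.adjoint_comp A B

theorem enorm_sconj_toLp (g : 𝓢(ℝ, ℂ)) :
    ‖(sconj g).toLp 2 (volume : Measure ℝ)‖ₑ = ‖g.toLp 2 (volume : Measure ℝ)‖ₑ := by
  rw [SchwartzMap.toLp, Lp.enorm_toLp, SchwartzMap.toLp, Lp.enorm_toLp]
  exact eLpNorm_congr_norm_ae (Eventually.of_forall fun x => by
    rw [sconj_apply, RCLike.norm_conj])

theorem hsq_fourierMult_mul_mulOp {φ : ℝ → ℂ} (hφ : BddMeas φ) (g : 𝓢(ℝ, ℂ)) :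
    hsq (fourierMult φ * mulOp g) = symSq φ * ‖g.toLp 2 (volume : Measure ℝ)‖ₑ ^ 2 := by
  rw [((hasRows_mulOp g).fourierMult_mul hφ).hsq_eq]
  simp_rw [enorm_smul, enorm_wave, mul_pow, RCLike.enorm_conj]
  rw [lintegral_mul_const _ (hφ.comp_scale.1.enorm.pow_const 2), symSq]

theorem hsq_mulOp_mul_fourierMult {φ : ℝ → ℂ} (hφ : BddMeas φ) (g : 𝓢(ℝ, ℂ)) :
    hsq (mulOp g * fourierMult φ) = symSq φ * ‖g.toLp 2 (volume : Measure ℝ)‖ₑ ^ 2 := by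
  rw [← hsq_adjoint, adjoint_opMul, adjoint_fourierMult hφ, adjoint_mulOp_schwartz,
    hsq_fourierMult_mul_mulOp hφ.conj, enorm_sconj_toLp, symSq, symSq]
  simp_rw [RCLike.enorm_conj]

theorem two_mul_hsq_sandwich_le {φ ψ : ℝ → ℂ} (hφ : BddMeas φ) (hψ : BddMeas ψ) (g : 𝓢(ℝ, ℂ)) :
    2 * hsq (fourierMult φ * mulOp g * fourierMult ψ) ≤
      (symSq (fun x => φ x * φ x) + symSq (fun x => ψ x * ψ x)) *
        ‖g.toLp 2 (volume : Measure ℝ)‖ₑ ^ 2 := by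
  rw [add_mul, ← hsq_fourierMult_mul_mulOp (hφ.mul hφ), ← hsq_mulOp_mul_fourierMult (hψ.mul hψ)]
  rw [(hasRows_sandwich hφ hψ g).hsq_eq, ((hasRows_mulOp g).fourierMult_mul (hφ.mul hφ)).hsq_eq,
    ((hasRows_mulOp g).mul_right _).hsq_eq, adjoint_fourierMult (hψ.mul hψ),
    ← lintegral_const_mul' _ _ (by simp)]
  have hmeas : Measurable fun ξ : ℝ => ‖(starRingEnd ℂ)
      (φ (2 * Real.pi * ξ) * φ (2 * Real.pi * ξ)) • wave g ξ‖ₑ ^ 2 := by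
    simp_rw [enorm_smul, enorm_wave]
    exact ((hφ.mul hφ).comp_scale.conj.1.enorm.mul_const _).pow_const 2
  rw [← lintegral_add_left hmeas]
  refine lintegral_mono fun ξ => ?_
  have hw : ‖wave g ξ‖ₑ ^ 2 = ∫⁻ η, ‖FT (wave g ξ) η‖ₑ ^ 2 := by
    rw [← enorm_sq_eq_lintegral, ← ofReal_norm, ← ofReal_norm, FT.norm_map]
  have hm : ∀ {m : ℝ → ℂ}, BddMeas m → ‖fourierMult m (wave g ξ)‖ₑ ^ 2 =
      ∫⁻ η, ‖m (2 * Real.pi * η)‖ₑ ^ 2 * ‖FT (wave g ξ) η‖ₑ ^ 2 := by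
    intro m hm
    have : ‖fourierMult m (wave g ξ)‖ₑ = ‖FT (fourierMult m (wave g ξ))‖ₑ := by
      rw [← ofReal_norm, ← ofReal_norm, FT.norm_map]
    rw [this, enorm_sq_eq_lintegral]
    apply lintegral_congr_ae
    filter_upwards [FT_fourierMult_ae hm (wave g ξ)] with η hη
    rw [hη, enorm_mul, mul_pow]
  rw [enorm_smul, enorm_smul, mul_pow, mul_pow, hw, hm hψ.conj, hm (hψ.mul hψ).conj]
  simp_rw [RCLike.enorm_conj, enorm_mul]
  have hF : AEMeasurable (fun η => ‖FT (wave g ξ) η‖ₑ ^ 2) (volume : Measure ℝ) :=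
    (Lp.aestronglyMeasurable _).enorm.pow_const 2
  rw [← mul_assoc, ← lintegral_const_mul'' _ hF, ← lintegral_const_mul'', ← lintegral_add_left']
  · refine lintegral_mono fun η => ?_
    rw [← add_mul, ← mul_assoc]
    refine mul_le_mul_left ?_ _
    generalize hx : ‖φ (2 * Real.pi * ξ)‖ₑ = x
    generalize hy : ‖ψ (2 * Real.pi * η)‖ₑ = y
    have hx' : x ≠ ∞ := hx ▸ enorm_ne_top
    have hy' : y ≠ ∞ := hy ▸ enorm_ne_top
    lift x to NNReal using hx'
    lift y to NNReal using hy'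
    norm_cast
    refine ENNReal.coe_le_coe.mpr ?_
    change 2 * (x : ℝ) ^ 2 * (y : ℝ) ^ 2 ≤ ((x : ℝ) * x) ^ 2 + ((y : ℝ) * y) ^ 2
    nlinarith [sq_nonneg ((x : ℝ) ^ 2 - (y : ℝ) ^ 2)]
  · exact hF.const_mul _
  · exact (hψ.comp_scale.1.enorm.pow_const 2).aemeasurable.mul hF

theorem trace_sandwich_mul_sandwich {φ₁ ψ₁ φ₂ ψ₂ : ℝ → ℂ} (hφ₁ : BddMeas φ₁) (hψ₁ : BddMeas ψ₁)
    (hφ₂ : BddMeas φ₂) (hψ₂ : BddMeas ψ₂) (g h : 𝓢(ℝ, ℂ))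
    (hA : IsHilbertSchmidt (fourierMult φ₁ * mulOp g * fourierMult ψ₁))
    (hB : IsHilbertSchmidt (fourierMult ψ₂ * mulOp h * fourierMult φ₂)) :
    trace ((fourierMult φ₁ * mulOp g * fourierMult ψ₁) *
        (fourierMult ψ₂ * mulOp h * fourierMult φ₂)) =
      ∫ η : ℝ, (ψ₁ (2 * Real.pi * η) * ψ₂ (2 * Real.pi * η)) *
        ⟪wave h η, fourierMult (fun x => φ₁ x * φ₂ x) (wave (sconj g) η)⟫_ℂ := by
  have hl := hasRows_sandwich hψ₁.conj hφ₁.conj (sconj g)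
  have had : ContinuousLinearMap.adjoint (fourierMult φ₁ * mulOp g * fourierMult ψ₁) =
      fourierMult (fun x => (starRingEnd ℂ) (ψ₁ x)) * mulOp (sconj g) *
        fourierMult (fun x => (starRingEnd ℂ) (φ₁ x)) := by
    rw [adjoint_opMul, adjoint_opMul, adjoint_fourierMult hφ₁, adjoint_fourierMult hψ₁,
      adjoint_mulOp_schwartz, mul_assoc]
  rw [← had] at hl
  rw [hl.trace_mul (hasRows_sandwich hψ₂ hφ₂ h) hA hB]
  congr 1
  ext η
  simp only [Complex.conj_conj]
  rw [inner_smul_left, inner_smul_right, Complex.conj_conj, ← adjoint_fourierMult hφ₂,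
    ContinuousLinearMap.adjoint_inner_left, ← opMul_apply, fourierMult_mul hφ₂ hφ₁]
  simp_rw [mul_comm (φ₂ _)]
  ring

theorem trace_mulOp_fourierMult_mulOp {ψ₁ ψ₂ : ℝ → ℂ} (hψ₁ : BddMeas ψ₁) (hψ₂ : BddMeas ψ₂)
    (g h : 𝓢(ℝ, ℂ)) (hA : IsHilbertSchmidt (mulOp g * fourierMult ψ₁))
    (hB : IsHilbertSchmidt (fourierMult ψ₂ * mulOp h)) :
    trace ((mulOp g * fourierMult ψ₁) * (fourierMult ψ₂ * mulOp h)) =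
      (∫ η : ℝ, ψ₁ (2 * Real.pi * η) * ψ₂ (2 * Real.pi * η)) * ∫ x, g x * h x := by
  have h1 : BddMeas (fun _ => (1 : ℂ)) := ⟨measurable_const, 1, fun _ => norm_one.le⟩
  have h2 := trace_sandwich_mul_sandwich h1 hψ₁ h1 hψ₂ g h
    (by rwa [fourierMult_one, one_mul]) (by rwa [fourierMult_one, mul_one])
  simp only [mul_one, fourierMult_one, one_mul, one_apply_eq_self] at h2
  rw [h2, ← integral_mul_const]
  congr 1
  ext η
  rw [inner_wave_wave]
  congr 2
  ext x
  rw [sconj_apply, Complex.conj_conj, mul_comm]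

/-! ### Integrals of powers of `((2πη)² + c²)⁻¹` -/

theorem integrable_inv_one_add_sq_pow (k : ℕ) :
    Integrable fun x : ℝ => ((1 + x ^ 2)⁻¹) ^ (k + 1) := by
  refine integrable_inv_one_add_sq.mono' (by fun_prop) (Eventually.of_forall fun x => ?_)
  have h1 : (1 + x ^ 2)⁻¹ ≤ 1 := inv_le_one_of_one_le₀ (by nlinarith [sq_nonneg x])
  have h2 : 0 ≤ (1 + x ^ 2)⁻¹ := by positivity
  rw [Real.norm_eq_abs, abs_of_nonneg (by positivity), pow_succ]
  exact mul_le_of_le_one_left h2 (pow_le_one₀ h2 h1)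

theorem tendsto_mul_inv_one_add_sq_pow {l : Filter ℝ} (hl : Tendsto (fun x : ℝ => x⁻¹) l (𝓝 0))
    (k : ℕ) : Tendsto (fun x : ℝ => x * ((1 + x ^ 2)⁻¹) ^ (k + 1)) l (𝓝 0) := by
  refine squeeze_zero_norm (fun x => ?_) (by simpa using hl.norm)
  have h1 : (1 + x ^ 2)⁻¹ ≤ 1 := inv_le_one_of_one_le₀ (by nlinarith [sq_nonneg x])
  have h2 : 0 ≤ (1 + x ^ 2)⁻¹ := by positivity
  rcases eq_or_ne x 0 with rfl | hx
  · simp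
  rw [norm_mul, norm_pow, norm_inv, pow_succ]
  rw [Real.norm_eq_abs, Real.norm_eq_abs, abs_of_pos (by positivity : 0 < 1 + x ^ 2)]
  have h3 : |x| * (1 + x ^ 2)⁻¹ ≤ |x|⁻¹ := by
    rw [← div_eq_mul_inv, ← one_div, div_le_div_iff₀ (by positivity) (abs_pos.mpr hx)]
    nlinarith [sq_abs x]
  calc |x| * ((1 + x ^ 2)⁻¹ ^ k * (1 + x ^ 2)⁻¹)
      = (1 + x ^ 2)⁻¹ ^ k * (|x| * (1 + x ^ 2)⁻¹) := by ring
    _ ≤ 1 * |x|⁻¹ := mul_le_mul (pow_le_one₀ h2 h1) h3 (by positivity) (by norm_num)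
    _ = |x|⁻¹ := one_mul _

theorem integral_inv_one_add_sq_pow_succ (k : ℕ) :
    ∫ x : ℝ, ((1 + x ^ 2)⁻¹) ^ (k + 2) =
      (2 * (k : ℝ) + 1) / (2 * k + 2) * ∫ x : ℝ, ((1 + x ^ 2)⁻¹) ^ (k + 1) := by
  have hd : ∀ x : ℝ, HasDerivAt (fun x : ℝ => x * ((1 + x ^ 2)⁻¹) ^ (k + 1))
      ((2 * (k : ℝ) + 2) * ((1 + x ^ 2)⁻¹) ^ (k + 2) - (2 * k + 1) * ((1 + x ^ 2)⁻¹) ^ (k + 1)) x := by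
    intro x
    have hx : (1 + x ^ 2) ≠ 0 := by positivity
    have h1 : HasDerivAt (fun x : ℝ => 1 + x ^ 2) (2 * x) x := by
      simpa using (hasDerivAt_pow 2 x).const_add 1
    have h2 := (hasDerivAt_id x).mul ((h1.inv hx).pow (k + 1))
    refine h2.congr_deriv ?_
    simp only [id, Pi.inv_apply, Pi.pow_apply, Nat.add_sub_cancel, one_mul]
    have h3 : x ^ 2 = (1 + x ^ 2) - 1 := by ring
    have h4 : x * ((k + 1 : ℕ) * (1 + x ^ 2)⁻¹ ^ k * (-(2 * x) / (1 + x ^ 2) ^ 2)) =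
        -(2 * (k + 1)) * x ^ 2 * (1 + x ^ 2)⁻¹ ^ k * ((1 + x ^ 2)⁻¹) ^ 2 := by
      push_cast
      rw [inv_pow _ 2]
      ring
    rw [h4]
    have h5 : x ^ 2 * (1 + x ^ 2)⁻¹ = 1 - (1 + x ^ 2)⁻¹ := by field_simp; ring
    linear_combination (-(2 * ((k : ℝ) + 1)) * (1 + x ^ 2)⁻¹ ^ (k + 1)) * h5
  have h1 := integrable_inv_one_add_sq_pow (k + 1)
  have h2 := integrable_inv_one_add_sq_pow k
  have h3 := integral_of_hasDerivAt_of_tendsto hd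
    ((h1.const_mul (2 * (k : ℝ) + 2)).sub (h2.const_mul (2 * (k : ℝ) + 1)))
    (tendsto_mul_inv_one_add_sq_pow tendsto_inv_atBot_zero k)
    (tendsto_mul_inv_one_add_sq_pow tendsto_inv_atTop_zero k)
  rw [integral_sub (h1.const_mul _) (h2.const_mul _), integral_const_mul, integral_const_mul,
    sub_zero] at h3
  have h4 : (2 * (k : ℝ) + 2) ≠ 0 := by positivity
  rw [div_mul_eq_mul_div, eq_div_iff h4]
  linarith

/-- The integral of `((2πη)² + c²)^{-k}`. -/
def J (k : ℕ) (c : ℝ) : ℝ := ∫ η : ℝ, (((2 * Real.pi * η) ^ 2 + c ^ 2)⁻¹) ^ k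

theorem symbol_scale {c : ℝ} (hc : c ≠ 0) (k : ℕ) (η : ℝ) :
    (((2 * Real.pi * η) ^ 2 + c ^ 2)⁻¹) ^ k =
      ((c ^ 2)⁻¹) ^ k * ((1 + (2 * Real.pi / c * η) ^ 2)⁻¹) ^ k := by
  rw [← mul_pow, ← mul_inv]
  congr 2
  field_simp
  ring

theorem integrable_symbol_pow {c : ℝ} (hc : c ≠ 0) (k : ℕ) :
    Integrable fun η : ℝ => (((2 * Real.pi * η) ^ 2 + c ^ 2)⁻¹) ^ (k + 1) := by
  simp_rw [symbol_scale hc]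
  exact ((integrable_inv_one_add_sq_pow k).comp_mul_left'
    (div_ne_zero (by positivity) hc)).const_mul _

theorem J_eq {c : ℝ} (hc : c ≠ 0) (k : ℕ) :
    J k c = ((c ^ 2)⁻¹) ^ k * (|c| / (2 * Real.pi) * ∫ x : ℝ, ((1 + x ^ 2)⁻¹) ^ k) := by
  rw [J]
  simp_rw [symbol_scale hc]
  rw [integral_const_mul, Measure.integral_comp_mul_left (fun x : ℝ => ((1 + x ^ 2)⁻¹) ^ k)]
  rw [inv_div, abs_div, abs_of_pos Real.two_pi_pos, smul_eq_mul]

theorem J_one {c : ℝ} (hc : c ≠ 0) : J 1 c = 1 / (2 * |c|) := by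
  rw [J_eq hc]
  simp only [pow_one]
  have := abs_pos.mpr hc
  rw [integral_univ_inv_one_add_sq, ← sq_abs]
  field_simp

theorem J_succ {c : ℝ} (hc : c ≠ 0) (k : ℕ) :
    J (k + 2) c = (2 * (k : ℝ) + 1) / (2 * k + 2) * (c ^ 2)⁻¹ * J (k + 1) c := by
  rw [J_eq hc, J_eq hc, integral_inv_one_add_sq_pow_succ]
  ring

theorem J_two {c : ℝ} (hc : c ≠ 0) : J 2 c = 1 / (4 * |c| ^ 3) := by
  have h := J_succ hc 0
  have := abs_pos.mpr hc
  rw [zero_add, zero_add, J_one hc, ← sq_abs] at h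
  rw [h]
  push_cast
  field_simp
  norm_num

theorem J_three {c : ℝ} (hc : c ≠ 0) : J 3 c = 3 / (16 * |c| ^ 5) := by
  have h := J_succ hc 1
  have := abs_pos.mpr hc
  rw [J_two hc, ← sq_abs] at h
  rw [h]
  push_cast
  field_simp
  norm_num

theorem enorm_res_sq (c ξ : ℝ) :
    ‖res c ξ‖ₑ ^ 2 = ENNReal.ofReal ((ξ ^ 2 + c ^ 2)⁻¹) := by
  rw [← ofReal_norm, ← ENNReal.ofReal_pow (norm_nonneg _), res, norm_inv, inv_pow,
    ← Complex.normSq_eq_norm_sq, normSq_res_den]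

theorem symSq_res {c : ℝ} (hc : c ≠ 0) : symSq (res c) = ENNReal.ofReal (1 / (2 * |c|)) := by
  rw [← J_one hc, J, ofReal_integral_eq_lintegral_ofReal]
  · rw [symSq]
    simp_rw [enorm_res_sq, pow_one]
  · simpa using integrable_symbol_pow hc 0
  · exact Eventually.of_forall fun η => by positivity

/-! ### Integrals of symbols -/

theorem integral_symbol_eq {φ : ℝ → ℂ} {F : ℝ → ℝ}
    (hφ : Integrable fun η : ℝ => φ (2 * Real.pi * η))
    (h : ∀ ξ, φ ξ + φ (-ξ) = 2 * F ξ) :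
    ∫ η : ℝ, φ (2 * Real.pi * η) = ((∫ η : ℝ, F (2 * Real.pi * η) : ℝ) : ℂ) := by
  have h1 := integral_neg_eq_self (fun η : ℝ => φ (2 * Real.pi * η)) volume
  have h2 : ∫ η : ℝ, (φ (2 * Real.pi * η) + φ (2 * Real.pi * -η)) =
      ∫ η : ℝ, (2 : ℂ) * ((F (2 * Real.pi * η) : ℝ) : ℂ) := by
    congr 1
    ext η
    rw [← h, mul_neg]
  rw [integral_add hφ hφ.comp_neg, h1, integral_const_mul, integral_complex_ofReal] at h2
  linear_combination h2 / 2

theorem res_eq {c : ℝ} (hc : c ≠ 0) (ξ : ℝ) :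
    res c ξ = (c - I * ξ) * (((ξ ^ 2 + c ^ 2)⁻¹ : ℝ) : ℂ) := by
  have h1 := res_den_ne_zero hc ξ
  have h2 : ((ξ : ℂ) ^ 2 + (c : ℂ) ^ 2) ≠ 0 := by
    norm_cast
    positivity
  rw [res]
  push_cast
  symm
  apply eq_inv_of_mul_eq_one_left
  have h5 : ((c : ℂ) - I * ξ) * (I * ξ + c) = (ξ : ℂ) ^ 2 + (c : ℂ) ^ 2 := by
    linear_combination (-(ξ : ℂ) ^ 2) * I_sq
  rw [mul_right_comm, h5, mul_inv_cancel₀ h2]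

theorem integrable_res_mul_res {c : ℝ} (hc : c ≠ 0) {φ : ℝ → ℂ} (hφ : BddMeas φ) :
    Integrable fun η : ℝ => res (-c) (2 * Real.pi * η) * (res c (2 * Real.pi * η) *
      φ (2 * Real.pi * η)) := by
  obtain ⟨hm, C, hC⟩ := hφ.comp_scale
  have h0 := (integrable_symbol_pow hc 0).const_mul C
  refine h0.mono' ?_ (Eventually.of_forall fun η => ?_)
  · exact (((measurable_res _).comp (by fun_prop)).mul
      (((measurable_res _).comp (by fun_prop)).mul hm)).aestronglyMeasurable
  · have h1 : ∀ c ξ : ℝ, ‖res c ξ‖ = (Real.sqrt (ξ ^ 2 + c ^ 2))⁻¹ := by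
      intro c ξ
      rw [res, norm_inv, Complex.norm_def, normSq_res_den]
    rw [norm_mul, norm_mul, h1, h1, neg_sq, ← mul_assoc, ← mul_inv, Real.mul_self_sqrt (by positivity),
      zero_add, pow_one, mul_comm]
    exact mul_le_mul_of_nonneg_right (hC η) (by positivity)

/-! ### The square roots of the resolvents -/

/-- The symbol of `(∂ + c)^{-1/2}`. -/
def rsq (c : ℝ) (ξ : ℝ) : ℂ := (I * ξ + c) ^ (-(1 / 2) : ℂ)

theorem rsqrtD_eq (c : ℝ) : rsqrtD c = fourierMult (rsq c) := rfl

theorem rsq_mul_rsq {c : ℝ} (hc : c ≠ 0) (ξ : ℝ) : rsq c ξ * rsq c ξ = res c ξ := by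
  rw [rsq, ← Complex.cpow_add _ _ (res_den_ne_zero hc ξ), res, ← Complex.cpow_neg_one]
  norm_num

theorem norm_rsq_le {c : ℝ} (hc : c ≠ 0) (ξ : ℝ) : ‖rsq c ξ‖ ≤ Real.sqrt |c|⁻¹ := by
  apply Real.le_sqrt_of_sq_le
  rw [sq, ← norm_mul, rsq_mul_rsq hc]
  exact norm_res_le hc ξ

theorem measurable_rsq (c : ℝ) : Measurable (rsq c) := by
  unfold rsq
  apply Measurable.pow_const
  fun_prop

theorem bddMeas_rsq {c : ℝ} (hc : c ≠ 0) : BddMeas (rsq c) :=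
  ⟨measurable_rsq c, _, norm_rsq_le hc⟩

theorem norm_rsqrtD_le {c : ℝ} (hc : c ≠ 0) : ‖rsqrtD (c : ℂ)‖ ≤ Real.sqrt |c|⁻¹ := by
  rw [rsqrtD_eq]
  exact norm_fourierMult_le (measurable_rsq c) (norm_rsq_le hc)

theorem rsqrtD_mul_rsqrtD {c : ℝ} (hc : c ≠ 0) : rsqrtD (c : ℂ) * rsqrtD c = Res c := by
  rw [rsqrtD_eq, fourierMult_mul (bddMeas_rsq hc) (bddMeas_rsq hc), Res]
  simp_rw [rsq_mul_rsq hc]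

/-! ### Families of operators and their orders in the spectral parameter -/

/-- The real spectral parameters `c = iκ²` with `|c| ≥ 1`. -/
abbrev Par : Type := {c : ℝ // 1 ≤ |c|}

/-- Families of operators that depend on the spectral parameter. -/
abbrev Fam : Type := Par → (L2 →L[ℂ] L2)

theorem Par.ne_zero (c : Par) : (c : ℝ) ≠ 0 := by
  intro h
  have := c.2
  rw [h, abs_zero] at this
  linarith

theorem Par.abs_pos (c : Par) : 0 < |(c : ℝ)| := zero_lt_one.trans_le c.2

theorem Par.inv_nonneg (c : Par) : 0 ≤ |(c : ℝ)|⁻¹ := _root_.inv_nonneg.mpr (abs_nonneg _)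

theorem Par.inv_le_one (c : Par) : |(c : ℝ)|⁻¹ ≤ 1 := inv_le_one_of_one_le₀ c.2

/-- The operator norm is `O(|c|⁻ⁿ)`. -/
def OB (n : ℕ) (A : Fam) : Prop :=
  ∃ C, 0 ≤ C ∧ ∀ c : Par, ‖A c‖ ≤ C * |(c : ℝ)|⁻¹ ^ n

/-- The Hilbert–Schmidt norm is `O(|c|^{1/2 - n})`. -/
def OH (n : ℕ) (A : Fam) : Prop :=
  ∃ C, 0 ≤ C ∧ ∀ c : Par, IsHilbertSchmidt (A c) ∧
    hs (A c) ≤ C * (Real.sqrt |(c : ℝ)| * |(c : ℝ)|⁻¹ ^ n)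

theorem OB.mul {m n : ℕ} {A B : Fam} (hA : OB m A) (hB : OB n B) : OB (m + n) (A * B) := by
  obtain ⟨C, hC, h⟩ := hA
  obtain ⟨D, hD, h'⟩ := hB
  refine ⟨C * D, mul_nonneg hC hD, fun c => ?_⟩
  have := c.inv_nonneg
  calc ‖(A * B) c‖ ≤ ‖A c‖ * ‖B c‖ := norm_mul_le _ _
    _ ≤ (C * |(c : ℝ)|⁻¹ ^ m) * (D * |(c : ℝ)|⁻¹ ^ n) :=
      mul_le_mul (h c) (h' c) (norm_nonneg _) (by positivity)
    _ = _ := by rw [pow_add]; ring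

theorem OB.add {n : ℕ} {A B : Fam} (hA : OB n A) (hB : OB n B) : OB n (A + B) := by
  obtain ⟨C, hC, h⟩ := hA
  obtain ⟨D, hD, h'⟩ := hB
  refine ⟨C + D, add_nonneg hC hD, fun c => ?_⟩
  rw [add_mul]
  exact (norm_add_le _ _).trans (add_le_add (h c) (h' c))

theorem OH.mul_left {m n : ℕ} {X A : Fam} (hX : OB m X) (hA : OH n A) : OH (m + n) (X * A) := by
  obtain ⟨C, hC, h⟩ := hX
  obtain ⟨D, hD, h'⟩ := hA
  refine ⟨C * D, mul_nonneg hC hD, fun c => ⟨(h' c).1.mul_left _, ?_⟩⟩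
  have := c.inv_nonneg
  calc hs ((X * A) c) ≤ ‖X c‖ * hs (A c) := hs_mul_left (h' c).1 _
    _ ≤ (C * |(c : ℝ)|⁻¹ ^ m) * (D * (Real.sqrt |(c : ℝ)| * |(c : ℝ)|⁻¹ ^ n)) :=
      mul_le_mul (h c) (h' c).2 (hs_nonneg _) (by positivity)
    _ = _ := by rw [pow_add]; ring

theorem OH.mul_right {m n : ℕ} {X A : Fam} (hA : OH m A) (hX : OB n X) : OH (m + n) (A * X) := by
  obtain ⟨C, hC, h⟩ := hX
  obtain ⟨D, hD, h'⟩ := hA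
  refine ⟨C * D, mul_nonneg hC hD, fun c => ⟨(h' c).1.mul_right _, ?_⟩⟩
  have := c.inv_nonneg
  calc hs ((A * X) c) ≤ ‖X c‖ * hs (A c) := hs_mul_right (h' c).1 _
    _ ≤ (C * |(c : ℝ)|⁻¹ ^ n) * (D * (Real.sqrt |(c : ℝ)| * |(c : ℝ)|⁻¹ ^ m)) :=
      mul_le_mul (h c) (h' c).2 (hs_nonneg _) (by positivity)
    _ = _ := by rw [pow_add]; ring

theorem OH.add {n : ℕ} {A B : Fam} (hA : OH n A) (hB : OH n B) : OH n (A + B) := by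
  obtain ⟨C, hC, h⟩ := hA
  obtain ⟨D, hD, h'⟩ := hB
  refine ⟨2 * (C + D), by positivity, fun c => ⟨(h c).1.add (h' c).1, ?_⟩⟩
  refine (hs_add (h c).1 (h' c).1).trans ?_
  linarith [(h c).2, (h' c).2]

theorem OH.mono {m n : ℕ} {A : Fam} (hA : OH n A) (hmn : m ≤ n) : OH m A := by
  obtain ⟨C, hC, h⟩ := hA
  refine ⟨C, hC, fun c => ⟨(h c).1, (h c).2.trans ?_⟩⟩
  gcongr C * (_ * ?_)
  exact pow_le_pow_of_le_one c.inv_nonneg c.inv_le_one hmn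

/-- Multiplication by a Schwartz function, as a constant family. -/
def M (f : 𝓢(ℝ, ℂ)) : Fam := fun _ => mulOp f

/-- The family `(∂ + c)⁻¹`. -/
def Rp : Fam := fun c => Res c

/-- The family `(∂ - c)⁻¹`. -/
def Rm : Fam := fun c => Res (-c)

theorem M_mul (f g : 𝓢(ℝ, ℂ)) : M (schwartzMul f g) = M f * M g := funext fun _ => mulOp_schwartzMul f g

theorem OB_M (f : 𝓢(ℝ, ℂ)) : OB 0 (M f) := by
  refine ⟨‖mulOp f‖, norm_nonneg _, fun c => ?_⟩
  rw [pow_zero, mul_one]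
  rfl

theorem hs_le_of_hsq_eq {T : L2 →L[ℂ] L2} {c : ℝ} (hc : c ≠ 0) {f : L2}
    (h : hsq T = symSq (res c) * ‖f‖ₑ ^ 2) :
    IsHilbertSchmidt T ∧ hs T ≤ ‖f‖ * (Real.sqrt |c| * |c|⁻¹ ^ 1) := by
  have hc' := abs_pos.mpr hc
  rw [symSq_res hc] at h
  refine ⟨isHilbertSchmidt_iff.mpr (h ▸ by finiteness), ?_⟩
  apply abs_le_of_sq_le_sq' _ (by positivity) |>.2
  rw [hs_sq, h, ENNReal.toReal_mul, ENNReal.toReal_pow, toReal_enorm,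
    ENNReal.toReal_ofReal (by positivity), mul_pow, mul_pow, Real.sq_sqrt hc'.le]
  have : |c| * (|c|⁻¹ ^ 1) ^ 2 = 1 / |c| := by field_simp
  rw [this, mul_comm]
  refine mul_le_mul_of_nonneg_left ?_ (sq_nonneg _)
  exact one_div_le_one_div_of_le hc' (by linarith)

/-- The properties of the families `Rp` and `Rm` used in the expansions. -/
structure IsRes (R : Fam) : Prop where
  ob : OB 1 R
  oh : ∀ f, OH 1 (R * M f)
  oh_right : ∀ f, OH 1 (M f * R)
  comm : ∀ f, M f * R = R * M f + R * M (sderiv f) * R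

theorem isRes_Rp : IsRes Rp where
  ob := ⟨1, zero_le_one, fun c => by simpa [Rp] using norm_Res_le c.ne_zero⟩
  oh f := ⟨_, norm_nonneg _, fun c => hs_le_of_hsq_eq c.ne_zero
    (hsq_fourierMult_mul_mulOp (bddMeas_res c.ne_zero) f)⟩
  oh_right f := ⟨_, norm_nonneg _, fun c => hs_le_of_hsq_eq c.ne_zero
    (hsq_mulOp_mul_fourierMult (bddMeas_res c.ne_zero) f)⟩
  comm f := funext fun c => mulOp_mul_Res c.ne_zero f

theorem isRes_Rm : IsRes Rm where
  ob := ⟨1, zero_le_one, fun c => by simpa [Rm] using norm_Res_le (neg_ne_zero.mpr c.ne_zero)⟩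
  oh f := ⟨_, norm_nonneg _, fun c => by
    have h := hs_le_of_hsq_eq (neg_ne_zero.mpr c.ne_zero)
      (hsq_fourierMult_mul_mulOp (bddMeas_res (neg_ne_zero.mpr c.ne_zero)) f)
    rwa [abs_neg] at h⟩
  oh_right f := ⟨_, norm_nonneg _, fun c => by
    have h := hs_le_of_hsq_eq (neg_ne_zero.mpr c.ne_zero)
      (hsq_mulOp_mul_fourierMult (bddMeas_res (neg_ne_zero.mpr c.ne_zero)) f)
    rwa [abs_neg] at h⟩
  comm f := funext fun c => mulOp_mul_Res (neg_ne_zero.mpr c.ne_zero) f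

/-! ### Commuting multiplication operators through multipliers -/

/-- `Q` is a multiplier of order `-n`, and `f Q = Q f + Q' f'` up to two orders. -/
structure Exp (n : ℕ) (Q Q' : Fam) : Prop where
  ob : OB n Q
  ob' : OB (n + 1) Q'
  oh : ∀ f, OH n (Q * M f)
  oh' : ∀ f, OH (n + 1) (Q' * M f)
  exp : ∀ f, OH (n + 2) (M f * Q - (Q * M f + Q' * M (sderiv f)))

theorem IsRes.exp {R : Fam} (h : IsRes R) : Exp 1 R (R * R) where
  ob := h.ob
  ob' := h.ob.mul h.ob
  oh := h.oh
  oh' f := by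
    rw [mul_assoc]
    exact OH.mul_left h.ob (h.oh f)
  exp f := by
    have h1 : M f * R - (R * M f + R * R * M (sderiv f)) =
        R * (R * M (sderiv (sderiv f)) * R) := by
      rw [h.comm f, mul_assoc R (M (sderiv f)) R, h.comm (sderiv f)]
      noncomm_ring
    rw [h1]
    exact OH.mul_left h.ob ((h.oh _).mul_right h.ob)

theorem Exp.exp_zero {n : ℕ} {Q Q' : Fam} (h : Exp n Q Q') (f : 𝓢(ℝ, ℂ)) :
    OH (n + 1) (M f * Q - Q * M f) := by
  have h1 := ((h.exp f).mono (Nat.le_succ _)).add (h.oh' (sderiv f))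
  convert h1 using 1
  noncomm_ring

theorem Exp.mul {m n : ℕ} {Q Q' P P' : Fam} (hQ : Exp m Q Q') (hP : Exp n P P') :
    Exp (m + n) (Q * P) (Q' * P + Q * P') where
  ob := hQ.ob.mul hP.ob
  ob' := by
    have h1 := hQ.ob'.mul hP.ob
    have h2 := hQ.ob.mul hP.ob'
    rw [show m + 1 + n = m + n + 1 by ring] at h1
    exact h1.add h2
  oh f := by
    rw [mul_assoc]
    exact OH.mul_left hQ.ob (hP.oh f)
  oh' f := by
    have h1 := OH.mul_left hQ.ob' (hP.oh f)
    have h2 := OH.mul_left hQ.ob (hP.oh' f)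
    rw [show m + 1 + n = m + n + 1 by ring] at h1
    rw [add_mul, mul_assoc, mul_assoc]
    exact h1.add h2
  exp f := by
    have h1 := (hQ.exp f).mul_right hP.ob
    have h2 := OH.mul_left hQ.ob (hP.exp f)
    have h3 := (OH.mul_left hQ.ob' (hP.exp_zero (sderiv f)))
    rw [show m + 2 + n = m + n + 2 by ring] at h1
    rw [show m + 1 + (n + 1) = m + n + 2 by ring] at h3
    convert (h1.add h2).add h3 using 1
    noncomm_ring

theorem Exp.add {n : ℕ} {Q Q' P P' : Fam} (hQ : Exp n Q Q') (hP : Exp n P P') :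
    Exp n (Q + P) (Q' + P') where
  ob := hQ.ob.add hP.ob
  ob' := hQ.ob'.add hP.ob'
  oh f := by
    rw [add_mul]
    exact (hQ.oh f).add (hP.oh f)
  oh' f := by
    rw [add_mul]
    exact (hQ.oh' f).add (hP.oh' f)
  exp f := by
    convert (hQ.exp f).add (hP.exp f) using 1
    noncomm_ring

theorem Exp.step_zero {n : ℕ} {R Q X W : Fam} {f g : 𝓢(ℝ, ℂ)} (hR : IsRes R)
    (hW : OH (n + 1) (W - Q * M g)) (hQ : Exp (n + 1) (R * Q) X) :
    OH (n + 2) (M f * R * W - R * Q * M (schwartzMul f g)) := by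
  have h1 := OH.mul_left ((OB_M f).mul hR.ob) hW
  have h2 := (hQ.exp_zero f).mul_right (OB_M g)
  rw [show 0 + 1 + (n + 1) = n + 2 by ring] at h1
  convert h1.add h2 using 1
  rw [M_mul]
  noncomm_ring

theorem Exp.step {n : ℕ} {R Q X W P : Fam} {f g : 𝓢(ℝ, ℂ)} (hR : IsRes R)
    (hW : OH (n + 2) (W - (Q * M g + P))) (hQ : Exp (n + 1) (R * Q) X) :
    OH (n + 3) (M f * R * W -
      (R * Q * M (schwartzMul f g) + X * M (schwartzMul (sderiv f) g) + M f * R * P)) := by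
  have h1 := OH.mul_left ((OB_M f).mul hR.ob) hW
  have h2 := (hQ.exp f).mul_right (OB_M g)
  rw [show 0 + 1 + (n + 2) = n + 3 by ring] at h1
  convert h1.add h2 using 1
  rw [M_mul, M_mul]
  noncomm_ring

theorem Exp.comm_mul {n : ℕ} {R Q X : Fam} (hQ : Exp n (R * Q) X) (f g : 𝓢(ℝ, ℂ)) :
    OH (n + 1) (M f * R * (Q * M g) - R * Q * M (schwartzMul f g)) := by
  convert (hQ.exp_zero f).mul_right (OB_M g) using 1
  rw [M_mul]
  noncomm_ring

/-! ### Expansions of the words of the first three traces -/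

theorem word_one_expansion (r : 𝓢(ℝ, ℂ)) :
    OH 4 (M r * Rp - (Rp * 1 * M r + Rp * Rp * M (sderiv r) +
      Rp * (Rp * Rp) * M (sderiv (sderiv r)))) := by
  have h := isRes_Rp
  have h1 := OH.mul_left (h.ob.mul h.ob) ((h.oh (sderiv (sderiv (sderiv r)))).mul_right h.ob)
  convert h1 using 1
  rw [h.comm r, mul_assoc Rp (M (sderiv r)) Rp, h.comm (sderiv r),
    mul_assoc Rp (M (sderiv (sderiv r))) Rp, h.comm (sderiv (sderiv r))]
  noncomm_ring

theorem word_two_expansion (q r : 𝓢(ℝ, ℂ)) :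
    OH 5 (M r * Rp * (M q * Rm * (M r * Rp)) -
      (Rp * (Rm * Rp) * M (schwartzMul r (schwartzMul q r)) +
        (Rp * (Rp * (Rm * Rp)) * M (schwartzMul (sderiv r) (schwartzMul q r)) +
          Rp * (Rm * Rm * Rp + Rm * (Rp * Rp)) * M (schwartzMul (sderiv r) (schwartzMul q r))) +
        Rp * (Rm * Rm * Rp + Rm * (Rp * Rp)) * M (schwartzMul r (schwartzMul (sderiv q) r)) +
        Rp * (Rm * (Rp * Rp)) * M (schwartzMul r (schwartzMul q (sderiv r))))) := by
  have ep := isRes_Rp.exp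
  have em := isRes_Rm.exp
  have h0 : OH 3 (M r * Rp - (Rp * M r + Rp * Rp * M (sderiv r))) := ep.exp r
  have h1 := Exp.step (f := q) isRes_Rm h0 (em.mul ep)
  have h1' := ((em.mul (ep.mul ep)).comm_mul q (sderiv r))
  have h2 : OH 4 (M q * Rm * (M r * Rp) - (Rm * Rp * M (schwartzMul q r) +
      ((Rm * Rm * Rp + Rm * (Rp * Rp)) * M (schwartzMul (sderiv q) r) +
        Rm * (Rp * Rp) * M (schwartzMul q (sderiv r))))) := by
    convert h1.add h1' using 1
    noncomm_ring
  have h3 := Exp.step (f := r) isRes_Rp h2 (ep.mul (em.mul ep))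
  have h4 := (ep.mul (((em.mul em).mul ep).add (em.mul (ep.mul ep)))).comm_mul r
    (schwartzMul (sderiv q) r)
  have h5 := (ep.mul (em.mul (ep.mul ep))).comm_mul r (schwartzMul q (sderiv r))
  convert (h3.add h4).add h5 using 1
  noncomm_ring

theorem word_three_expansion (q r : 𝓢(ℝ, ℂ)) :
    OH 6 (M r * Rp * (M q * Rm * (M r * Rp * (M q * Rm * (M r * Rp)))) -
      Rp * (Rm * (Rp * (Rm * Rp))) * M (schwartzMul r (schwartzMul q (schwartzMul r (schwartzMul q r))))) := by
  have ep := isRes_Rp.exp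
  have em := isRes_Rm.exp
  have e2 := em.mul ep
  have e3 := ep.mul e2
  have e4 := em.mul e3
  have e5 := ep.mul e4
  exact Exp.step_zero isRes_Rp (Exp.step_zero isRes_Rm (Exp.step_zero isRes_Rp
    (Exp.step_zero isRes_Rm (ep.exp_zero r) e2) e3) e4) e5

/-! ### Asymptotics of the first three traces -/

/-- A scalar family of order `O(|c|⁻ⁿ)`. -/
def OT (n : ℕ) (t : Par → ℂ) : Prop :=
  ∃ C, 0 ≤ C ∧ ∀ c : Par, ‖t c‖ ≤ C * |(c : ℝ)|⁻¹ ^ n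

theorem OT_trace {n : ℕ} {A : Fam} (q : 𝓢(ℝ, ℂ)) (hA : OH n A) :
    OT n fun c => trace ((M q * Rm * A) c) := by
  obtain ⟨C, hC, h⟩ := isRes_Rm.oh_right q
  obtain ⟨D, hD, h'⟩ := hA
  refine ⟨C * D, mul_nonneg hC hD, fun c => ?_⟩
  have := c.inv_nonneg
  refine (norm_trace_mul_le (h c).1 (h' c).1).trans ((mul_le_mul (h c).2 (h' c).2 (hs_nonneg _)
    (by positivity)).trans (le_of_eq ?_))
  have h1 : Real.sqrt |(c : ℝ)| * Real.sqrt |(c : ℝ)| = |(c : ℝ)| :=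
    Real.mul_self_sqrt (abs_nonneg _)
  have h2 : |(c : ℝ)| * |(c : ℝ)|⁻¹ = 1 := mul_inv_cancel₀ c.abs_pos.ne'
  linear_combination (C * D * |(c : ℝ)|⁻¹ ^ n * |(c : ℝ)|⁻¹) * h1 +
    (C * D * |(c : ℝ)|⁻¹ ^ n) * h2

theorem trace_mul_add {m n : ℕ} {A B : Fam} (q : 𝓢(ℝ, ℂ)) (hA : OH m A) (hB : OH n B) (c : Par) :
    trace ((M q * Rm * (A + B)) c) = trace ((M q * Rm * A) c) + trace ((M q * Rm * B) c) := by
  obtain ⟨C, hC, h⟩ := isRes_Rm.oh_right q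
  obtain ⟨D, hD, h'⟩ := hA
  obtain ⟨E, hE, h''⟩ := hB
  rw [mul_add, Pi.add_apply]
  exact trace_add (traceSummable_mul (h c).1 (h' c).1) (traceSummable_mul (h c).1 (h'' c).1)

theorem OT_trace_sub {m n : ℕ} {W A : Fam} (q : 𝓢(ℝ, ℂ)) (hW : OH n (W - A)) (hA : OH m A) :
    OT n fun c => trace ((M q * Rm * W) c) - trace ((M q * Rm * A) c) := by
  have h := OT_trace q hW
  have h1 : ∀ c, trace ((M q * Rm * W) c) - trace ((M q * Rm * A) c) =
      trace ((M q * Rm * (W - A)) c) := by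
    intro c
    rw [sub_eq_iff_eq_add, ← trace_mul_add q hW hA, sub_add_cancel]
  simpa only [h1] using h

theorem res_neg_mul_res (c : Par) (ξ : ℝ) :
    res (-c) ξ * res c ξ = -(((ξ ^ 2 + (c : ℝ) ^ 2)⁻¹ : ℝ) : ℂ) := by
  have h1 := res_den_ne_zero c.ne_zero ξ
  have h2 := res_den_ne_zero (neg_ne_zero.mpr c.ne_zero) ξ
  rw [res, res, ← mul_inv]
  push_cast
  rw [neg_inv]
  congr 1
  linear_combination ((ξ : ℂ) ^ 2) * I_sq

theorem res_add_res_neg (c : Par) (ξ : ℝ) :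
    res c ξ + res c (-ξ) = 2 * c * (((ξ ^ 2 + (c : ℝ) ^ 2)⁻¹ : ℝ) : ℂ) := by
  rw [res_eq c.ne_zero, res_eq c.ne_zero, neg_sq]
  push_cast
  ring

theorem trace_mul_Rp_mul {P : Fam} {c : Par} {χ : ℝ → ℂ} (hP : P c = fourierMult χ)
    (hχ : BddMeas χ) (q f : 𝓢(ℝ, ℂ)) :
    trace ((M q * Rm * (Rp * P * M f)) c) =
      (∫ η : ℝ, res (-c) (2 * Real.pi * η) * (res c (2 * Real.pi * η) * χ (2 * Real.pi * η))) *
        ∫ x, q x * f x := by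
  have hp := bddMeas_res c.ne_zero
  have hm := bddMeas_res (neg_ne_zero.mpr c.ne_zero)
  have h1 : Rp c * P c = fourierMult fun x => res c x * χ x := by
    rw [hP, ← fourierMult_mul hp hχ]
    rfl
  have h2 : Rp c * P c = P c * Rp c := by
    rw [h1, hP]
    change _ = fourierMult χ * fourierMult (res c)
    rw [fourierMult_mul hχ hp]
    simp_rw [mul_comm]
  have hB : IsHilbertSchmidt (Rp c * P c * mulOp f) := by
    rw [h2, mul_assoc]
    obtain ⟨C, _, h⟩ := isRes_Rp.oh f
    exact (h c).1.mul_left _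
  obtain ⟨C, _, h⟩ := isRes_Rm.oh_right q
  have hA := (h c).1
  change trace ((mulOp q * fourierMult (res (-c))) * (Rp c * P c * mulOp f)) = _
  rw [h1] at hB ⊢
  exact trace_mulOp_fourierMult_mulOp hm (hp.mul hχ) q f hA hB

theorem trace_mul_Rp_mul_eq {P : Fam} {c : Par} {χ : ℝ → ℂ} (hP : P c = fourierMult χ)
    (hχ : BddMeas χ) {F : ℝ → ℝ} (hF : ∀ ξ, res (-c) ξ * (res c ξ * χ ξ) +
      res (-c) (-ξ) * (res c (-ξ) * χ (-ξ)) = 2 * F ξ) (q f : 𝓢(ℝ, ℂ)) :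
    trace ((M q * Rm * (Rp * P * M f)) c) =
      ((∫ η : ℝ, F (2 * Real.pi * η) : ℝ) : ℂ) * ∫ x, q x * f x := by
  rw [trace_mul_Rp_mul hP hχ,
    integral_symbol_eq (φ := fun ξ => res (-c) ξ * (res c ξ * χ ξ))
      (integrable_res_mul_res c.ne_zero hχ) hF]

theorem Rp_mul_Rp (c : Par) : (Rp * Rp) c = fourierMult fun x => res c x * res c x :=
  fourierMult_mul (bddMeas_res c.ne_zero) (bddMeas_res c.ne_zero)

theorem Rm_mul {P : Fam} {c : Par} {χ : ℝ → ℂ} (hP : P c = fourierMult χ) (hχ : BddMeas χ) :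
    (Rm * P) c = fourierMult fun x => res (-c) x * χ x := by
  rw [← fourierMult_mul (bddMeas_res (neg_ne_zero.mpr c.ne_zero)) hχ, ← hP]
  rfl

theorem Rp_mul {P : Fam} {c : Par} {χ : ℝ → ℂ} (hP : P c = fourierMult χ) (hχ : BddMeas χ) :
    (Rp * P) c = fourierMult fun x => res c x * χ x := by
  rw [← fourierMult_mul (bddMeas_res c.ne_zero) hχ, ← hP]
  rfl

theorem bddMeas_Rp (c : Par) : BddMeas (res c) := bddMeas_res c.ne_zero

theorem bddMeas_Rm (c : Par) : BddMeas (res (-c)) := bddMeas_res (neg_ne_zero.mpr c.ne_zero)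

theorem trace_word_one (q r : 𝓢(ℝ, ℂ)) :
    OT 4 fun c => trace ((M q * Rm * (M r * Rp)) c) -
      (-(J 1 c : ℂ) * ∫ x, q x * r x) - (-(c : ℂ) * J 2 c * ∫ x, q x * sderiv r x) -
      ((J 2 c - 2 * c ^ 2 * J 3 c) * ∫ x, q x * sderiv (sderiv r) x) := by
  have ep := isRes_Rp.exp
  have e1 : OH 0 (Rp * 1 * M r) := by
    rw [mul_one]
    exact (ep.oh r).mono (by norm_num)
  have e2 : OH 0 (Rp * Rp * M (sderiv r)) := ((ep.mul ep).oh _).mono (by norm_num)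
  have e3 : OH 0 (Rp * (Rp * Rp) * M (sderiv (sderiv r))) :=
    ((ep.mul (ep.mul ep)).oh _).mono (by norm_num)
  have h := OT_trace_sub q (word_one_expansion r) ((e1.add e2).add e3)
  convert h using 2 with c
  rw [trace_mul_add q (e1.add e2) e3, trace_mul_add q e1 e2]
  have hc := res_neg_mul_res c
  have hs := res_add_res_neg c
  have v1 : trace ((M q * Rm * (Rp * 1 * M r)) c) = -(J 1 c : ℂ) * ∫ x, q x * r x := by
    rw [trace_mul_Rp_mul_eq (χ := fun _ => 1) (F := fun ξ => -((ξ ^ 2 + (c : ℝ) ^ 2)⁻¹) ^ 1)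
      fourierMult_one.symm ⟨measurable_const, 1, fun _ => norm_one.le⟩, integral_neg, ← J]
    · push_cast
      ring
    · intro ξ
      rw [mul_one, mul_one, hc, hc, neg_sq]
      push_cast
      ring
  have v2 : trace ((M q * Rm * (Rp * Rp * M (sderiv r))) c) =
      -(c : ℂ) * J 2 c * ∫ x, q x * sderiv r x := by
    rw [trace_mul_Rp_mul_eq (χ := res c)
      (F := fun ξ => -(c : ℝ) * ((ξ ^ 2 + (c : ℝ) ^ 2)⁻¹) ^ 2) rfl (bddMeas_Rp c),
      integral_const_mul, ← J]
    · push_cast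
      ring
    · intro ξ
      rw [← mul_assoc, ← mul_assoc, hc, hc, neg_sq, ← mul_add, hs]
      push_cast
      ring
  have v3 : trace ((M q * Rm * (Rp * (Rp * Rp) * M (sderiv (sderiv r)))) c) =
      (J 2 c - 2 * c ^ 2 * J 3 c) * ∫ x, q x * sderiv (sderiv r) x := by
    rw [trace_mul_Rp_mul_eq (F := fun ξ => ((ξ ^ 2 + (c : ℝ) ^ 2)⁻¹) ^ 2 -
        2 * (c : ℝ) ^ 2 * ((ξ ^ 2 + (c : ℝ) ^ 2)⁻¹) ^ 3)
      (Rp_mul_Rp c) ((bddMeas_Rp c).mul (bddMeas_Rp c)),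
      integral_sub (integrable_symbol_pow c.ne_zero 1)
        ((integrable_symbol_pow c.ne_zero 2).const_mul _), integral_const_mul, ← J, ← J]
    · push_cast
      ring
    · intro ξ
      have hd : (((ξ ^ 2 + (c : ℝ) ^ 2)⁻¹ : ℝ) : ℂ) * ((ξ : ℂ) ^ 2 + (c : ℂ) ^ 2) = 1 := by
        norm_cast
        exact inv_mul_cancel₀ (by have := c.ne_zero; positivity)
      rw [← mul_assoc, ← mul_assoc (res (-c) (-ξ)), hc, hc, neg_sq, res_eq c.ne_zero,
        res_eq c.ne_zero, neg_sq]
      generalize (ξ ^ 2 + (c : ℝ) ^ 2)⁻¹ = d at *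
      push_cast at hd ⊢
      linear_combination 2 * (d : ℂ) ^ 2 * hd - 2 * (d : ℂ) ^ 3 * (ξ : ℂ) ^ 2 * I_sq
  rw [v1, v2, v3]
  ring

theorem trace_word_two (q r : 𝓢(ℝ, ℂ)) :
    OT 5 fun c => trace ((M q * Rm * (M r * Rp * (M q * Rm * (M r * Rp)))) c) -
      (J 2 c * ∫ x, q x ^ 2 * r x ^ 2) -
      (2 * c * J 3 c * ∫ x, q x ^ 2 * r x * sderiv r x) := by
  have ep := isRes_Rp.exp
  have em := isRes_Rm.exp
  have e1 : OH 0 (Rp * (Rm * Rp) * M (schwartzMul r (schwartzMul q r))) :=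
    ((ep.mul (em.mul ep)).oh _).mono (by norm_num)
  have e2 : OH 0 (Rp * (Rp * (Rm * Rp)) * M (schwartzMul (sderiv r) (schwartzMul q r))) :=
    ((ep.mul (ep.mul (em.mul ep))).oh _).mono (by norm_num)
  have e3 : ∀ f, OH 0 (Rp * (Rm * Rm * Rp + Rm * (Rp * Rp)) * M f) := fun f =>
    ((ep.mul (((em.mul em).mul ep).add (em.mul (ep.mul ep)))).oh _).mono (by norm_num)
  have e4 : OH 0 (Rp * (Rm * (Rp * Rp)) * M (schwartzMul r (schwartzMul q (sderiv r)))) :=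
    ((ep.mul (em.mul (ep.mul ep))).oh _).mono (by norm_num)
  have h := OT_trace_sub q (word_two_expansion q r)
    (((e1.add (e2.add (e3 _))).add (e3 _)).add e4)
  convert h using 2 with c
  rw [trace_mul_add q ((e1.add (e2.add (e3 _))).add (e3 _)) e4,
    trace_mul_add q (e1.add (e2.add (e3 _))) (e3 _), trace_mul_add q e1 (e2.add (e3 _)),
    trace_mul_add q e2 (e3 _)]
  have hc := res_neg_mul_res c
  have hs := res_add_res_neg c
  have bp := bddMeas_Rp c
  have bm := bddMeas_Rm c
  have v1 : trace ((M q * Rm * (Rp * (Rm * Rp) * M (schwartzMul r (schwartzMul q r)))) c) =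
      J 2 c * ∫ x, q x ^ 2 * r x ^ 2 := by
    rw [trace_mul_Rp_mul_eq (F := fun ξ => ((ξ ^ 2 + (c : ℝ) ^ 2)⁻¹) ^ 2)
      (Rm_mul rfl bp) (bm.mul bp), ← J]
    · congr 2
      ext x
      simp only [schwartzMul_apply]
      ring
    · intro ξ
      rw [← mul_assoc, ← mul_assoc (res (-c) (-ξ)), hc, hc, neg_sq]
      push_cast
      ring
  have v2 : trace ((M q * Rm * (Rp * (Rp * (Rm * Rp)) * M (schwartzMul (sderiv r) (schwartzMul q r)))) c) =
      c * J 3 c * ∫ x, q x ^ 2 * r x * sderiv r x := by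
    rw [trace_mul_Rp_mul_eq (F := fun ξ => (c : ℝ) * ((ξ ^ 2 + (c : ℝ) ^ 2)⁻¹) ^ 3)
      (Rp_mul (Rm_mul rfl bp) (bm.mul bp)) (bp.mul (bm.mul bp)), integral_const_mul, ← J]
    · push_cast
      congr 2
      ext x
      simp only [schwartzMul_apply]
      ring
    · intro ξ
      have h1 := hc ξ
      have h2 := hc (-ξ)
      rw [neg_sq] at h2
      have h3 := hs ξ
      generalize (ξ ^ 2 + (c : ℝ) ^ 2)⁻¹ = d at *
      rw [← mul_assoc, ← mul_assoc (res (-c) (-ξ)), h1, h2]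
      push_cast
      linear_combination (d : ℂ) ^ 2 * h3
  have v3 : ∀ f, trace ((M q * Rm * (Rp * (Rm * Rm * Rp + Rm * (Rp * Rp)) * M f)) c) = 0 := by
    intro f
    have b1 := bm.mul (bm.mul bp)
    have b2 := bm.mul (bp.mul bp)
    have hP : (Rm * Rm * Rp + Rm * (Rp * Rp)) c = fourierMult fun x =>
        res (-c) x * (res (-c) x * res c x) + res (-c) x * (res c x * res c x) := by
      rw [Pi.add_apply, mul_assoc, Rm_mul (Rm_mul rfl bp) (bm.mul bp),
        Rm_mul (Rp_mul_Rp c) (bp.mul bp), fourierMult_add b1 b2]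
    rw [trace_mul_Rp_mul_eq (F := fun _ => 0) hP]
    · simp
    · exact b1.add b2
    · intro ξ
      have h1 := hc ξ
      have h2 := hc (-ξ)
      rw [neg_sq] at h2
      have h3 := res_add_res_neg c ξ
      have h4 := res_add_res_neg ⟨-c, by rw [abs_neg]; exact c.2⟩ ξ
      simp only [neg_sq] at h4
      generalize (ξ ^ 2 + (c : ℝ) ^ 2)⁻¹ = d at *
      push_cast at h4 ⊢
      rw [← mul_assoc, ← mul_assoc (res (-c) (-ξ)), h1, h2]
      linear_combination (d : ℂ) ^ 2 * (h3 + h4) - (d : ℂ) * res c ξ * h1 -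
        (d : ℂ) * res c (-ξ) * h2
  have v4 : trace ((M q * Rm * (Rp * (Rm * (Rp * Rp)) * M (schwartzMul r (schwartzMul q (sderiv r))))) c) =
      c * J 3 c * ∫ x, q x ^ 2 * r x * sderiv r x := by
    rw [trace_mul_Rp_mul_eq (F := fun ξ => (c : ℝ) * ((ξ ^ 2 + (c : ℝ) ^ 2)⁻¹) ^ 3)
      (Rm_mul (Rp_mul_Rp c) (bp.mul bp)) (bm.mul (bp.mul bp)), integral_const_mul, ← J]
    · push_cast
      congr 2
      ext x
      simp only [schwartzMul_apply]
      ring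
    · intro ξ
      have h1 := hc ξ
      have h2 := hc (-ξ)
      rw [neg_sq] at h2
      have h3 := hs ξ
      generalize (ξ ^ 2 + (c : ℝ) ^ 2)⁻¹ = d at *
      rw [← mul_assoc, ← mul_assoc (res (-c) (-ξ)), h1, h2]
      push_cast
      linear_combination (d : ℂ) ^ 2 * h3 - (d : ℂ) * res c ξ * h1 - (d : ℂ) * res c (-ξ) * h2
  rw [v1, v2, v3, v3, v4]
  ring

theorem trace_word_three (q r : 𝓢(ℝ, ℂ)) :
    OT 6 fun c => trace ((M q * Rm * (M r * Rp * (M q * Rm * (M r * Rp *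
      (M q * Rm * (M r * Rp)))))) c) - (-(J 3 c : ℂ) * ∫ x, q x ^ 3 * r x ^ 3) := by
  have ep := isRes_Rp.exp
  have em := isRes_Rm.exp
  have h := OT_trace_sub q (word_three_expansion q r)
    ((ep.mul (em.mul (ep.mul (em.mul ep)))).oh _)
  convert h using 2 with c
  congr 1
  have hc := res_neg_mul_res c
  have bp := bddMeas_Rp c
  have bm := bddMeas_Rm c
  rw [trace_mul_Rp_mul_eq (F := fun ξ => -((ξ ^ 2 + (c : ℝ) ^ 2)⁻¹) ^ 3)
    (Rm_mul (Rp_mul (Rm_mul rfl bp) (bm.mul bp)) (bp.mul (bm.mul bp)))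
    (bm.mul (bp.mul (bm.mul bp))), integral_neg, ← J]
  · push_cast
    congr 2
    ext x
    simp only [schwartzMul_apply]
    ring
  · intro ξ
    have h1 := hc ξ
    have h2 := hc (-ξ)
    rw [neg_sq] at h2
    have h3 : ∀ a b : ℂ, a * (b * (a * (b * (a * b)))) = (a * b) ^ 3 := fun a b => by ring
    rw [h3, h3, h1, h2]
    push_cast
    ring

/-! ### The operators `Λ` and `Γ` -/

/-- The operator `(∂ + c)^{-1/2} f (∂ - c)^{-1/2}`. -/
def sandwich (c : ℝ) (f : 𝓢(ℝ, ℂ)) : L2 →L[ℂ] L2 :=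
  rsqrtD (c : ℂ) * mulOp f * rsqrtD ((-c : ℝ) : ℂ)

theorem sandwich_hs {c : ℝ} (hc : c ≠ 0) (f : 𝓢(ℝ, ℂ)) :
    IsHilbertSchmidt (sandwich c f) ∧
      |c| * hs (sandwich c f) ^ 2 ≤ ‖f.toLp 2 (volume : Measure ℝ)‖ ^ 2 / 2 := by
  have hc' : -c ≠ 0 := neg_ne_zero.mpr hc
  have h := two_mul_hsq_sandwich_le (bddMeas_rsq hc) (bddMeas_rsq hc') f
  rw [← rsqrtD_eq, ← rsqrtD_eq, ← sandwich] at h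
  have e1 : (fun x => rsq c x * rsq c x) = res c := funext (rsq_mul_rsq hc)
  have e2 : (fun x => rsq (-c) x * rsq (-c) x) = res (-c) := funext (rsq_mul_rsq hc')
  have hpos := abs_pos.mpr hc
  rw [e1, e2, symSq_res hc, symSq_res hc', abs_neg, ← ENNReal.ofReal_add (by positivity)
    (by positivity)] at h
  have hfin : hsq (sandwich c f) ≠ ∞ := by
    intro h0
    rw [h0, ENNReal.mul_top (by norm_num), top_le_iff] at h
    exact absurd h (by finiteness)
  refine ⟨isHilbertSchmidt_iff.mpr hfin, ?_⟩
  have h1 := ENNReal.toReal_mono (by finiteness) h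
  rw [ENNReal.toReal_mul, ENNReal.toReal_mul, ENNReal.toReal_pow, toReal_enorm,
    ENNReal.toReal_ofReal (by positivity), ← hs_sq, ENNReal.toReal_ofNat] at h1
  have h2 : 1 / (2 * |c|) + 1 / (2 * |c|) = |c|⁻¹ := by field_simp; norm_num
  rw [h2] at h1
  have h3 := mul_le_mul_of_nonneg_left h1 hpos.le
  rw [← mul_assoc |c| |c|⁻¹, mul_inv_cancel₀ hpos.ne', one_mul] at h3
  linarith

theorem norm_sandwich_le {c : ℝ} (hc : c ≠ 0) (f : 𝓢(ℝ, ℂ)) :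
    ‖sandwich c f‖ ≤ ‖mulOp f‖ * |c|⁻¹ := by
  have h1 := norm_rsqrtD_le hc
  have h2 := norm_rsqrtD_le (neg_ne_zero.mpr hc)
  rw [abs_neg] at h2
  have h3 : Real.sqrt |c|⁻¹ * Real.sqrt |c|⁻¹ = |c|⁻¹ := Real.mul_self_sqrt (by positivity)
  calc ‖sandwich c f‖ ≤ ‖rsqrtD (c : ℂ)‖ * ‖mulOp f‖ * ‖rsqrtD ((-c : ℝ) : ℂ)‖ :=
        (norm_mul_le _ _).trans (mul_le_mul_of_nonneg_right (norm_mul_le _ _) (norm_nonneg _))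
    _ ≤ Real.sqrt |c|⁻¹ * ‖mulOp f‖ * Real.sqrt |c|⁻¹ := by gcongr
    _ = _ := by linear_combination ‖mulOp f‖ * h3

/-- The real spectral parameter `c = iκ²`. -/
def par (κ : ℂ) : ℝ := (I * κ ^ 2).re

theorem par_coe {κ : ℂ} (h : κ ∈ spectralSet) : ((par κ : ℝ) : ℂ) = I * κ ^ 2 := by
  apply Complex.ext
  · rfl
  · rw [Complex.ofReal_im]
    exact h.symm

theorem abs_par {κ : ℂ} (h : κ ∈ spectralSet) : |par κ| = ‖κ‖ ^ 2 := by
  rw [← Real.norm_eq_abs, ← Complex.norm_real, par_coe h, norm_mul, norm_I, one_mul, norm_pow]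

theorem kappa_sq {κ : ℂ} (h : κ ∈ spectralSet) : κ ^ 2 = -I * par κ := by
  rw [par_coe h]
  linear_combination κ ^ 2 * I_sq

theorem Lam_eq {κ : ℂ} (h : κ ∈ spectralSet) (f : 𝓢(ℝ, ℂ)) :
    Lam κ f = κ • sandwich (par κ) f := by
  have h1 : -(I * κ ^ 2) = ((-par κ : ℝ) : ℂ) := by rw [← par_coe h]; push_cast; rfl
  change rsqrtD (I * κ ^ 2) * ((κ • mulOp f) * rsqrtD (-(I * κ ^ 2))) = _
  rw [h1, ← par_coe h, sandwich, smul_mul_assoc, mul_smul_comm, mul_assoc]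

theorem Gam_eq {κ : ℂ} (h : κ ∈ spectralSet) (f : 𝓢(ℝ, ℂ)) :
    Gam κ f = κ • sandwich (-par κ) f := by
  have h1 : -(I * κ ^ 2) = ((-par κ : ℝ) : ℂ) := by rw [← par_coe h]; push_cast; rfl
  change rsqrtD (-(I * κ ^ 2)) * ((κ • mulOp f) * rsqrtD (I * κ ^ 2)) = _
  rw [h1, ← par_coe h, sandwich, smul_mul_assoc, mul_smul_comm, mul_assoc, neg_neg]

theorem hs_smul_sq_le {T : L2 →L[ℂ] L2} (h : IsHilbertSchmidt T) (z : ℂ) :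
    hs (z • T) ^ 2 ≤ ‖z‖ ^ 2 * hs T ^ 2 := by
  have h1 := hs_mul_left h (z • 1)
  have h2 : ‖z • (1 : L2 →L[ℂ] L2)‖ ≤ ‖z‖ := by
    refine (norm_smul_le z (1 : L2 →L[ℂ] L2)).trans (mul_le_of_le_one_right (norm_nonneg _) ?_)
    exact ContinuousLinearMap.norm_id_le
  rw [smul_mul_assoc, one_mul] at h1
  rw [← mul_pow]
  exact pow_le_pow_left₀ (hs_nonneg _)
    (h1.trans (mul_le_mul_of_nonneg_right h2 (hs_nonneg _))) 2

theorem smul_sandwich_hs {κ : ℂ} (hκ1 : 1 ≤ ‖κ‖) {c : ℝ} (hc : |c| = ‖κ‖ ^ 2)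
    (f : 𝓢(ℝ, ℂ)) : IsHilbertSchmidt (κ • sandwich c f) ∧
      hs (κ • sandwich c f) ^ 2 ≤ ‖f.toLp 2 (volume : Measure ℝ)‖ ^ 2 / 2 := by
  have hc0 : c ≠ 0 := by
    rw [← abs_pos, hc]
    positivity
  obtain ⟨h1, h2⟩ := sandwich_hs hc0 f
  refine ⟨h1.smul κ, (hs_smul_sq_le h1 κ).trans ?_⟩
  rwa [← hc]

theorem norm_smul_sandwich_le {κ : ℂ} (hκ1 : 1 ≤ ‖κ‖) {c : ℝ} (hc : |c| = ‖κ‖ ^ 2)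
    (f : 𝓢(ℝ, ℂ)) : ‖κ • sandwich c f‖ ≤ ‖mulOp f‖ * ‖κ‖⁻¹ := by
  have hc0 : c ≠ 0 := by
    rw [← abs_pos, hc]
    positivity
  rw [norm_smul]
  refine (mul_le_mul_of_nonneg_left (norm_sandwich_le hc0 f) (norm_nonneg κ)).trans (le_of_eq ?_)
  rw [hc]
  field_simp

/-! ### Powers of `ΛΓ` -/

theorem mul_pow_hs {T : L2 →L[ℂ] L2} (h : IsHilbertSchmidt T) (X : L2 →L[ℂ] L2) (m : ℕ) :
    IsHilbertSchmidt (T * X ^ m) ∧ hs (T * X ^ m) ≤ ‖X‖ ^ m * hs T := by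
  induction m with
  | zero => simpa using h
  | succ m ih =>
    rw [pow_succ, ← mul_assoc]
    refine ⟨ih.1.mul_right X, (hs_mul_right ih.1 X).trans ?_⟩
    rw [pow_succ, mul_comm (‖X‖ ^ m), mul_assoc]
    exact mul_le_mul_of_nonneg_left ih.2 (norm_nonneg _)

theorem isTraceClass_pow {S T : L2 →L[ℂ] L2} (hS : IsHilbertSchmidt S) (hT : IsHilbertSchmidt T)
    (m : ℕ) : IsTraceClass ((S * T) ^ (m + 1)) := by
  refine ⟨S, T * (S * T) ^ m, hS, (mul_pow_hs hT _ m).1, ?_⟩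
  rw [pow_succ']
  exact mul_assoc _ _ _

theorem norm_trace_pow_le {S T : L2 →L[ℂ] L2} (hS : IsHilbertSchmidt S)
    (hT : IsHilbertSchmidt T) (m : ℕ) :
    ‖trace ((S * T) ^ (m + 1))‖ ≤ hs S * hs T * (‖S‖ * ‖T‖) ^ m := by
  have h1 : (S * T) ^ (m + 1) = S * (T * (S * T) ^ m) := by rw [pow_succ', mul_assoc]
  rw [h1]
  obtain ⟨h2, h3⟩ := mul_pow_hs hT (S * T) m
  refine (norm_trace_mul_le hS h2).trans ?_
  rw [mul_assoc, mul_comm (hs T)]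
  refine mul_le_mul_of_nonneg_left (h3.trans ?_) (hs_nonneg S)
  exact mul_le_mul_of_nonneg_right (pow_le_pow_left₀ (norm_nonneg _) (norm_mul_le _ _) m)
    (hs_nonneg T)

theorem norm_sign_le (c : ℝ) : ‖(Real.sign c : ℂ)‖ ≤ 1 := by
  rw [Complex.norm_real]
  rcases Real.sign_apply_eq c with h | h | h <;> rw [h] <;> simp

theorem norm_Aterm_le (κ : ℂ) (q r : ℝ → ℂ) (m : ℕ) :
    ‖Aterm κ q r (m + 1)‖ ≤ ‖trace ((Lam κ q * Gam κ r) ^ (m + 1))‖ := by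
  rw [Aterm, norm_mul, norm_mul, norm_neg]
  have h2 : ‖(1 / ((m + 1 : ℕ) : ℂ))‖ ≤ 1 := by
    rw [norm_div, norm_one, Complex.norm_natCast]
    exact div_le_one_of_le₀ (by simp) (by positivity)
  exact mul_le_of_le_one_left (norm_nonneg _) (mul_le_one₀ (norm_sign_le _) (norm_nonneg _) h2)

theorem neg_ne {c : ℝ} (hc : c ≠ 0) : -c ≠ 0 := neg_ne_zero.mpr hc

theorem sandwich_mul_sandwich {c : ℝ} (hc : c ≠ 0) (q r : 𝓢(ℝ, ℂ)) :
    sandwich c q * sandwich (-c) r =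
      rsqrtD (c : ℂ) * (mulOp q * Res (-c) * mulOp r) * rsqrtD (c : ℂ) := by
  rw [sandwich, sandwich, neg_neg, ← rsqrtD_mul_rsqrtD (neg_ne hc)]
  simp only [mul_assoc]

theorem trace_sandwich_one (c : Par) (q r : 𝓢(ℝ, ℂ)) :
    trace (sandwich c q * sandwich (-c) r) = trace ((M q * Rm * (M r * Rp)) c) := by
  have hc := c.ne_zero
  have hc' := neg_ne hc
  have h1 := trace_sandwich_mul_sandwich (bddMeas_rsq hc) (bddMeas_rsq hc') (bddMeas_rsq hc)
    (bddMeas_rsq hc') q r (sandwich_hs hc q).1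
    (by have := (sandwich_hs hc' r).1; rwa [sandwich, neg_neg] at this)
  have b1 : BddMeas (fun _ => (1 : ℂ)) := ⟨measurable_const, 1, fun _ => norm_one.le⟩
  obtain ⟨_, _, hA⟩ := isRes_Rm.oh_right q
  obtain ⟨_, _, hB⟩ := isRes_Rp.oh_right r
  have h2 := trace_sandwich_mul_sandwich b1 (bddMeas_res hc') (bddMeas_res hc) b1 q r
    (by rw [fourierMult_one, one_mul]; exact (hA c).1)
    (by rw [fourierMult_one, one_mul]; exact (hB c).1)
  simp only [one_mul, mul_one, fourierMult_one] at h2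
  simp only [rsq_mul_rsq hc, rsq_mul_rsq hc'] at h1
  have h3 : sandwich c q * sandwich (-c) r = fourierMult (rsq c) * mulOp q *
      fourierMult (rsq (-c)) * (fourierMult (rsq (-c)) * mulOp r * fourierMult (rsq c)) := by
    rw [sandwich, sandwich, neg_neg]
    rfl
  rw [h3, h1]
  exact h2.symm

theorem trace_conj_mul {c : Par} (q : 𝓢(ℝ, ℂ)) (r : 𝓢(ℝ, ℂ)) (X : L2 →L[ℂ] L2) :
    trace (rsqrtD ((c : ℝ) : ℂ) * (mulOp q * Res (-c) * (mulOp r * Res c * X))) =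
      trace (mulOp q * Res (-c) * (mulOp r * Res c * X) * rsqrtD ((c : ℝ) : ℂ)) := by
  obtain ⟨_, _, hA⟩ := isRes_Rm.oh_right q
  obtain ⟨_, _, hB⟩ := isRes_Rp.oh_right r
  exact IsTraceClass.trace_mul_comm ⟨mulOp q * Res (-c), mulOp r * Res c * X, (hA c).1,
    (hB c).1.mul_right X, rfl⟩ _

theorem trace_sandwich_two (c : Par) (q r : 𝓢(ℝ, ℂ)) :
    trace ((sandwich c q * sandwich (-c) r) ^ 2) =
      trace ((M q * Rm * (M r * Rp * (M q * Rm * (M r * Rp)))) c) := by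
  have h := trace_conj_mul (c := c) q r (mulOp q * Res (-c) * mulOp r * rsqrtD ((c : ℝ) : ℂ))
  change _ = trace (mulOp q * Res (-c) * (mulOp r * Res c *
    (mulOp q * Res (-c) * (mulOp r * Res c))))
  rw [sandwich_mul_sandwich c.ne_zero]
  simp only [← rsqrtD_mul_rsqrtD c.ne_zero, pow_succ, pow_zero, one_mul, mul_assoc] at h ⊢
  exact h

theorem trace_sandwich_three (c : Par) (q r : 𝓢(ℝ, ℂ)) :
    trace ((sandwich c q * sandwich (-c) r) ^ 3) =
      trace ((M q * Rm * (M r * Rp * (M q * Rm * (M r * Rp *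
        (M q * Rm * (M r * Rp)))))) c) := by
  have h := trace_conj_mul (c := c) q r (mulOp q * Res (-c) * (mulOp r * Res c *
    (mulOp q * Res (-c) * mulOp r * rsqrtD ((c : ℝ) : ℂ))))
  change _ = trace (mulOp q * Res (-c) * (mulOp r * Res c *
    (mulOp q * Res (-c) * (mulOp r * Res c * (mulOp q * Res (-c) * (mulOp r * Res c))))))
  rw [sandwich_mul_sandwich c.ne_zero]
  simp only [← rsqrtD_mul_rsqrtD c.ne_zero, pow_succ, pow_zero, one_mul, mul_assoc] at h ⊢
  exact h

/-! ### The Sobolev norm -/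

theorem hat_eq (q : 𝓢(ℝ, ℂ)) (ξ : ℝ) :
    hat q ξ = ((1 / Real.sqrt (2 * Real.pi) : ℝ) : ℂ) * (𝓕 q) (ξ / (2 * Real.pi)) := by
  rw [hat, SchwartzMap.fourier_coe, Real.fourier_eq']
  congr 2
  ext x
  rw [smul_eq_mul]
  congr 2
  simp only [RCLike.inner_apply, conj_trivial]
  have : (Real.pi : ℂ) ≠ 0 := by exact_mod_cast Real.pi_ne_zero
  push_cast
  field_simp

theorem integrable_weight_mul_norm_sq (f : 𝓢(ℝ, ℂ)) {s : ℝ} (hs1 : s ≤ 1) :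
    Integrable fun η : ℝ => (4 + (2 * Real.pi * η) ^ 2) ^ s * ‖f η‖ ^ 2 := by
  obtain ⟨hm, K, hK⟩ := bddMeas_schwartz f
  have h0 := f.integrable_pow_mul volume 0
  have h2 := f.integrable_pow_mul volume 2
  refine ((h0.const_mul (4 * K)).add (h2.const_mul ((2 * Real.pi) ^ 2 * K))).mono' ?_
    (Eventually.of_forall fun η => ?_)
  · refine Measurable.aestronglyMeasurable (Measurable.mul ?_ (hm.norm.pow_const 2))
    exact Measurable.pow_const (by fun_prop) s
  · have h3 : (4 + (2 * Real.pi * η) ^ 2) ^ s ≤ 4 + (2 * Real.pi * η) ^ 2 := by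
      conv_rhs => rw [← Real.rpow_one (4 + (2 * Real.pi * η) ^ 2)]
      exact Real.rpow_le_rpow_of_exponent_le (by nlinarith [sq_nonneg (2 * Real.pi * η)]) hs1
    rw [Real.norm_of_nonneg (by positivity)]
    calc (4 + (2 * Real.pi * η) ^ 2) ^ s * ‖f η‖ ^ 2
        ≤ (4 + (2 * Real.pi * η) ^ 2) * (K * ‖f η‖) := by
          refine mul_le_mul h3 ?_ (by positivity) (by positivity)
          rw [sq]
          exact mul_le_mul_of_nonneg_right (hK η) (norm_nonneg _)
      _ = _ := by
          simp only [Pi.add_apply, pow_zero, one_mul, Real.norm_eq_abs, sq_abs]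
          ring

theorem norm_toLp_sq (q : 𝓢(ℝ, ℂ)) :
    ‖q.toLp 2 (volume : Measure ℝ)‖ ^ 2 = ∫ x, ‖q x‖ ^ 2 := by
  have h : ⟪q.toLp 2 (volume : Measure ℝ), q.toLp 2 (volume : Measure ℝ)⟫_ℂ =
      ((∫ x, ‖q x‖ ^ 2 : ℝ) : ℂ) := by
    rw [L2.inner_def, ← integral_complex_ofReal]
    apply integral_congr_ae
    filter_upwards [q.coeFn_toLp 2] with x hx
    rw [hx, inner_self_eq_norm_sq_to_K]
    norm_cast
  rw [inner_self_eq_norm_sq_to_K] at h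
  refine Complex.ofReal_injective ?_
  rw [← h, Complex.ofReal_pow]
  rfl

theorem norm_toLp_le_sobolevNorm (q : 𝓢(ℝ, ℂ)) {s : ℝ} (hs0 : 0 ≤ s) (hs1 : s ≤ 1) :
    ‖q.toLp 2 (volume : Measure ℝ)‖ ≤ sobolevNorm s q := by
  apply Real.le_sqrt_of_sq_le
  have hpi := Real.two_pi_pos
  have h1 : ∀ ξ : ℝ, (4 + ξ ^ 2) ^ s * ‖hat q ξ‖ ^ 2 = (2 * Real.pi)⁻¹ *
      ((4 + (2 * Real.pi * (ξ / (2 * Real.pi))) ^ 2) ^ s * ‖(𝓕 q) (ξ / (2 * Real.pi))‖ ^ 2) := by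
    intro ξ
    rw [hat_eq, norm_mul, mul_pow, Complex.norm_real, Real.norm_eq_abs, sq_abs, div_pow,
      Real.sq_sqrt hpi.le, mul_div_cancel₀ _ hpi.ne']
    ring
  simp_rw [h1]
  have h2 := Measure.integral_comp_div (fun η : ℝ =>
    (4 + (2 * Real.pi * η) ^ 2) ^ s * ‖(𝓕 q) η‖ ^ 2) (2 * Real.pi)
  rw [integral_const_mul, h2, abs_of_pos hpi, smul_eq_mul, ← mul_assoc,
    inv_mul_cancel₀ hpi.ne', one_mul, norm_toLp_sq, ← SchwartzMap.integral_norm_sq_fourier]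
  have h0 := integrable_weight_mul_norm_sq (𝓕 q) (s := 0) zero_le_one
  simp only [Real.rpow_zero, one_mul] at h0
  refine integral_mono h0 (integrable_weight_mul_norm_sq _ hs1) fun η => ?_
  refine le_mul_of_one_le_left (sq_nonneg _) (Real.one_le_rpow ?_ hs0)
  nlinarith [sq_nonneg (2 * Real.pi * η)]

/-! ### The expansion of `A(κ)` -/

theorem main_terms_eq {c : ℝ} (hc : c ≠ 0) (a₀ a₁ a₂ b b₁ e : ℂ) :
    -(Real.sign c : ℂ) * (1 / (1 : ℕ)) * ((-I * c) ^ 1 * (-(J 1 c : ℂ) * a₀ +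
        -(c : ℂ) * J 2 c * a₁ + (J 2 c - 2 * c ^ 2 * J 3 c) * a₂)) +
      -(Real.sign c : ℂ) * (1 / (2 : ℕ)) * ((-I * c) ^ 2 * (J 2 c * b + 2 * c * J 3 c * b₁)) +
      -(Real.sign c : ℂ) * (1 / (3 : ℕ)) * ((-I * c) ^ 3 * (-(J 3 c : ℂ) * e)) =
    (-I) * (a₀ / 2) - (-I) ^ 2 / (2 * c) * ((-I * a₁ + 1 / 2 * b) / 2) +
      (-I) ^ 3 / (2 * c) ^ 2 * ((-a₂ - 3 / 2 * I * b₁ + 1 / 2 * e) / 2) := by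
  have h2 : (-I : ℂ) ^ 2 = -1 := by rw [neg_sq, I_sq]
  have h3 : (-I : ℂ) ^ 3 = I := by rw [pow_succ, h2]; ring
  have hc' : (c : ℂ) ≠ 0 := by exact_mod_cast hc
  rw [J_one hc, J_two hc, J_three hc, mul_pow, mul_pow, mul_pow, h2, h3, pow_one]
  rcases lt_or_gt_of_ne hc with h | h
  · rw [Real.sign_of_neg h, abs_of_neg h]
    push_cast
    field_simp
    ring_nf
    simp only [I_sq]
    ring
  · rw [Real.sign_of_pos h, abs_of_pos h]
    push_cast
    field_simp
    ring_nf
    simp only [I_sq]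
    ring

/-- The Schwartz function `-conj q`. -/
def snegConj (q : 𝓢(ℝ, ℂ)) : 𝓢(ℝ, ℂ) := -sconj q

theorem coe_snegConj (q : 𝓢(ℝ, ℂ)) : negConj q = snegConj q := by
  ext x
  simp [negConj, snegConj, sconj_apply]

theorem norm_snegConj_toLp (q : 𝓢(ℝ, ℂ)) :
    ‖(snegConj q).toLp 2 (volume : Measure ℝ)‖ = ‖q.toLp 2 (volume : Measure ℝ)‖ := by
  rw [← sq_eq_sq₀ (norm_nonneg _) (norm_nonneg _), norm_toLp_sq, norm_toLp_sq]
  simp [snegConj, sconj_apply]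

theorem Lam_mul_Gam_pow {κ : ℂ} (h : κ ∈ spectralSet) (q r : 𝓢(ℝ, ℂ)) (m : ℕ) :
    (Lam κ q * Gam κ r) ^ m =
      ((-I * par κ) ^ m) • (sandwich (par κ) q * sandwich (-par κ) r) ^ m := by
  rw [Lam_eq h, Gam_eq h, smul_mul_smul_comm, smul_pow, ← sq, kappa_sq h]

theorem integrable_schwartzMul (f g : 𝓢(ℝ, ℂ)) : Integrable fun x => f x * g x := by
  refine (schwartzMul f g).integrable.congr (Eventually.of_forall fun x => ?_)
  exact schwartzMul_apply f g x

theorem integral_mul_sderiv (f g : 𝓢(ℝ, ℂ)) :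
    ∫ x, f x * sderiv g x = -∫ x, sderiv f x * g x :=
  SchwartzMap.integral_mul_deriv_eq_neg_deriv_mul f g

theorem hamiltonian_eq (q r : 𝓢(ℝ, ℂ)) : hamiltonian q r =
    -I * (∫ x, q x * sderiv r x) + 1 / 2 * ∫ x, q x ^ 2 * r x ^ 2 := by
  have h1 := (integrable_schwartzMul q (sderiv r)).const_mul (-I)
  have h2 := (integrable_schwartzMul (schwartzMul q q) (schwartzMul r r)).const_mul (1 / 2)
  rw [hamiltonian, ← integral_const_mul, ← integral_const_mul]
  simp only [schwartzMul_apply] at h2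
  rw [← integral_add h1 (h2.congr (Eventually.of_forall fun x => by ring))]
  congr 1
  ext x
  rw [sderiv_apply]
  ring

theorem energy_eq (q r : 𝓢(ℝ, ℂ)) : energy q r =
    -(∫ x, q x * sderiv (sderiv r) x) - 3 / 2 * I * (∫ x, q x ^ 2 * r x * sderiv r x) +
      1 / 2 * ∫ x, q x ^ 3 * r x ^ 3 := by
  have h1 := integrable_schwartzMul (sderiv q) (sderiv r)
  have h2 := (integrable_schwartzMul (schwartzMul (schwartzMul q q) r) (sderiv r)).const_mul (3 / 2 * I)
  have h3 := (integrable_schwartzMul (schwartzMul q (schwartzMul q q)) (schwartzMul r (schwartzMul r r))).const_mul (1 / 2)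
  simp only [schwartzMul_apply] at h2 h3
  have h2' : Integrable fun x => 3 / 2 * I * (q x ^ 2 * r x * sderiv r x) :=
    h2.congr (Eventually.of_forall fun x => by ring)
  have h3' : Integrable fun x => 1 / 2 * (q x ^ 3 * r x ^ 3) :=
    h3.congr (Eventually.of_forall fun x => by ring)
  have h4 : Integrable fun x => sderiv q x * sderiv r x - 3 / 2 * I * (q x ^ 2 * r x * sderiv r x) :=
    h1.sub h2'
  rw [energy, integral_mul_sderiv, neg_neg, ← integral_const_mul, ← integral_const_mul,
    ← integral_sub h1 h2', ← integral_add h4 h3']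
  congr 1
  ext x
  simp only [sderiv_apply]
  ring

/-- A term of order `O(|c|^{-3-m})` in the trace contributes `O(|c|⁻³)` to `A`. -/
theorem OT.scale {m : ℕ} {t : Par → ℂ} (h : OT (3 + (m + 1)) t) :
    ∃ C, 0 ≤ C ∧ ∀ c : Par, ‖-(Real.sign c : ℂ) * (1 / ((m + 1 : ℕ) : ℂ)) *
      ((-I * (c : ℝ)) ^ (m + 1) * t c)‖ ≤ C * |(c : ℝ)|⁻¹ ^ 3 := by
  obtain ⟨C, hC, h⟩ := h
  refine ⟨C, hC, fun c => ?_⟩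
  have h2 : ‖(1 / ((m + 1 : ℕ) : ℂ))‖ ≤ 1 := by
    rw [norm_div, norm_one, Complex.norm_natCast]
    exact div_le_one_of_le₀ (by simp) (by positivity)
  rw [norm_mul, norm_mul, norm_neg]
  refine (mul_le_of_le_one_left (norm_nonneg _)
    (mul_le_one₀ (norm_sign_le c) (norm_nonneg _) h2)).trans ?_
  rw [norm_mul, norm_pow, norm_mul, norm_neg, norm_I, one_mul, Complex.norm_real,
    Real.norm_eq_abs]
  refine (mul_le_mul_of_nonneg_left (h c) (by positivity)).trans (le_of_eq ?_)
  have hp : |(c : ℝ)| ^ (m + 1) * |(c : ℝ)|⁻¹ ^ (m + 1) = 1 := by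
    rw [← mul_pow, mul_inv_cancel₀ c.abs_pos.ne', one_pow]
  rw [pow_add]
  linear_combination (C * |(c : ℝ)|⁻¹ ^ 3) * hp

theorem head_expansion (q r : 𝓢(ℝ, ℂ)) : ∃ C, 0 ≤ C ∧ ∀ κ ∈ spectralSet, 1 ≤ ‖κ‖ →
    ‖Aterm κ q r 1 + Aterm κ q r 2 + Aterm κ q r 3 - ((-I) * (mass q r / 2)
      - (-I) ^ 2 / (2 * I * κ ^ 2) * (hamiltonian q r / 2)
      + (-I) ^ 3 / (2 * I * κ ^ 2) ^ 2 * (energy q r / 2))‖ ≤ C * (|par κ|⁻¹) ^ 3 := by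
  obtain ⟨C₁, hC₁, h₁⟩ := (trace_word_one q r).scale (m := 0)
  obtain ⟨C₂, hC₂, h₂⟩ := (trace_word_two q r).scale (m := 1)
  obtain ⟨C₃, hC₃, h₃⟩ := (trace_word_three q r).scale (m := 2)
  refine ⟨C₁ + C₂ + C₃, by positivity, fun κ hκ hκ1 => ?_⟩
  have hpar : 1 ≤ |par κ| := by
    rw [abs_par hκ]
    exact one_le_pow₀ hκ1
  set c : Par := ⟨par κ, hpar⟩ with hcdef
  have hm := main_terms_eq c.ne_zero (∫ x, q x * r x) (∫ x, q x * sderiv r x)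
    (∫ x, q x * sderiv (sderiv r) x) (∫ x, q x ^ 2 * r x ^ 2)
    (∫ x, q x ^ 2 * r x * sderiv r x) (∫ x, q x ^ 3 * r x ^ 3)
  have hA : ∀ m, Aterm κ q r m = -(Real.sign c : ℂ) * (1 / (m : ℂ)) *
      ((-I * (c : ℝ)) ^ m * trace ((sandwich c q * sandwich (-c) r) ^ m)) := by
    intro m
    have := Lam_mul_Gam_pow hκ q r m
    change -(Real.sign (par κ) : ℂ) * (1 / (m : ℂ)) * trace ((Lam κ q * Gam κ r) ^ m) = _
    rw [this, trace_smul]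
  have hk : 2 * I * κ ^ 2 = 2 * ((c : ℝ) : ℂ) := by
    rw [hcdef, par_coe hκ]
    ring
  rw [hA, hA, hA, hk, hamiltonian_eq, energy_eq, mass, ← hm, pow_one (sandwich c q * _),
    trace_sandwich_one, trace_sandwich_two, trace_sandwich_three]
  have h := norm_add₃_le.trans (add_le_add (add_le_add (h₁ c) (h₂ c)) (h₃ c))
  rw [← add_mul, ← add_mul] at h
  refine (le_of_eq ?_).trans h
  congr 1
  simp only [zero_add, Nat.reduceAdd]
  ring

theorem small_hs {κ : ℂ} (hκ : κ ∈ spectralSet) (hκ1 : 1 ≤ ‖κ‖) {f : 𝓢(ℝ, ℂ)}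
    (hf : ‖f.toLp 2 (volume : Measure ℝ)‖ ≤ 1) :
    (IsHilbertSchmidt (Lam κ f) ∧ hs (Lam κ f) ^ 2 ≤ 1 / 2) ∧
      (IsHilbertSchmidt (Gam κ f) ∧ hs (Gam κ f) ^ 2 ≤ 1 / 2) := by
  have h1 := smul_sandwich_hs hκ1 (abs_par hκ) f
  have h2 := smul_sandwich_hs hκ1 (c := -par κ) (by rw [abs_neg, abs_par hκ]) f
  have h3 : ‖f.toLp 2 (volume : Measure ℝ)‖ ^ 2 / 2 ≤ 1 / 2 := by
    have := pow_le_one₀ (n := 2) (norm_nonneg _) hf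
    linarith
  rw [Lam_eq hκ, Gam_eq hκ]
  exact ⟨⟨h1.1, h1.2.trans h3⟩, ⟨h2.1, h2.2.trans h3⟩⟩

theorem norm_Aterm_le_pow {κ : ℂ} (hκ : κ ∈ spectralSet) (hκ1 : 1 ≤ ‖κ‖) {q r : 𝓢(ℝ, ℂ)}
    (hq : ‖q.toLp 2 (volume : Measure ℝ)‖ ≤ 1) (hr : ‖r.toLp 2 (volume : Measure ℝ)‖ ≤ 1)
    (m : ℕ) : ‖Aterm κ q r (m + 1)‖ ≤ 1 / 2 * (‖Lam κ q‖ * ‖Gam κ r‖) ^ m ∧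
      ‖Lam κ q‖ * ‖Gam κ r‖ ≤ 1 / 2 := by
  obtain ⟨hL, hL'⟩ := (small_hs hκ hκ1 hq).1
  obtain ⟨hG, hG'⟩ := (small_hs hκ hκ1 hr).2
  have h1 : hs (Lam κ q) * hs (Gam κ r) ≤ 1 / 2 := by
    nlinarith [sq_nonneg (hs (Lam κ q) - hs (Gam κ r))]
  refine ⟨(norm_Aterm_le κ q r m).trans ((norm_trace_pow_le hL hG m).trans ?_), ?_⟩
  · exact mul_le_mul_of_nonneg_right h1 (by positivity)
  · exact (mul_le_mul (norm_le_hs hL) (norm_le_hs hG) (norm_nonneg _) (hs_nonneg _)).trans h1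

theorem summable_norm_Aterm {κ : ℂ} (hκ : κ ∈ spectralSet) (hκ1 : 1 ≤ ‖κ‖) {q r : 𝓢(ℝ, ℂ)}
    (hq : ‖q.toLp 2 (volume : Measure ℝ)‖ ≤ 1) (hr : ‖r.toLp 2 (volume : Measure ℝ)‖ ≤ 1) :
    Summable fun m : ℕ => ‖Aterm κ q r (m + 1)‖ := by
  have hg := (summable_geometric_of_lt_one (r := (1 / 2 : ℝ)) (by norm_num)
    (by norm_num)).mul_left (1 / 2)
  refine Summable.of_nonneg_of_le (fun _ => norm_nonneg _) (fun m => ?_) hg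
  obtain ⟨h1, h2⟩ := norm_Aterm_le_pow hκ hκ1 hq hr m
  refine h1.trans (mul_le_mul_of_nonneg_left ?_ (by norm_num))
  exact pow_le_pow_left₀ (by positivity) h2 m

theorem norm_Lam_mul_norm_Gam_le {κ : ℂ} (hκ : κ ∈ spectralSet) (hκ1 : 1 ≤ ‖κ‖)
    (q r : 𝓢(ℝ, ℂ)) :
    ‖Lam κ q‖ * ‖Gam κ r‖ ≤ ‖mulOp q‖ * ‖mulOp r‖ * |par κ|⁻¹ := by
  have h1 := norm_smul_sandwich_le hκ1 (abs_par hκ) q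
  have h2 := norm_smul_sandwich_le hκ1 (c := -par κ) (by rw [abs_neg, abs_par hκ]) r
  rw [← Lam_eq hκ] at h1
  rw [← Gam_eq hκ] at h2
  refine (mul_le_mul h1 h2 (norm_nonneg _) (by positivity)).trans (le_of_eq ?_)
  rw [abs_par hκ, sq, mul_inv]
  ring

theorem norm_A_sub_head_le {κ : ℂ} (hκ : κ ∈ spectralSet) (hκ1 : 1 ≤ ‖κ‖) {q r : 𝓢(ℝ, ℂ)}
    (hq : ‖q.toLp 2 (volume : Measure ℝ)‖ ≤ 1) (hr : ‖r.toLp 2 (volume : Measure ℝ)‖ ≤ 1) :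
    ‖A κ q r - (Aterm κ q r 1 + Aterm κ q r 2 + Aterm κ q r 3)‖ ≤
      (‖mulOp q‖ * ‖mulOp r‖) ^ 3 * |par κ|⁻¹ ^ 3 := by
  have hsum := summable_norm_Aterm hκ hκ1 hq hr
  have h1 := hsum.of_norm.sum_add_tsum_nat_add 3
  have h2 : A κ q r - (Aterm κ q r 1 + Aterm κ q r 2 + Aterm κ q r 3) =
      ∑' m : ℕ, Aterm κ q r (m + 3 + 1) := by
    rw [A, ← h1]
    simp only [Finset.sum_range_succ, Finset.sum_range_zero]
    ring
  rw [h2]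
  set B := (‖mulOp q‖ * ‖mulOp r‖) ^ 3 * |par κ|⁻¹ ^ 3 with hB
  have hg : HasSum (fun m : ℕ => (1 / 2 * B) * (1 / 2 : ℝ) ^ m) ((1 / 2 * B) * 2) :=
    hasSum_geometric_two.mul_left _
  refine (tsum_of_norm_bounded hg fun m => ?_).trans (le_of_eq (by ring))
  obtain ⟨h3, h4⟩ := norm_Aterm_le_pow hκ hκ1 hq hr (m + 3)
  refine h3.trans ?_
  have h5 := norm_Lam_mul_norm_Gam_le hκ hκ1 q r
  have h6 : 0 ≤ ‖Lam κ q‖ * ‖Gam κ r‖ := by positivity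
  rw [pow_add, mul_assoc (1 / 2 : ℝ) B, mul_comm B, hB, ← mul_pow]
  refine mul_le_mul_of_nonneg_left ?_ (by norm_num)
  exact mul_le_mul (pow_le_pow_left₀ h6 h4 m) (pow_le_pow_left₀ h6 h5 3) (by positivity)
    (by positivity)

end DNLS

end

theorem mainTheorem8 :
    ∃ δ : ℝ, 0 < δ ∧ ∀ s : ℝ, 0 ≤ s → s < 1 / 2 →
      ∀ q : 𝓢(ℝ, ℂ), DNLS.sobolevNorm s q ≤ δ →
        -- the series that defines `A(κ)` is meaningful and converges absolutely
        (∀ κ ∈ DNLS.spectralSet, 1 ≤ ‖κ‖ →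
          DNLS.IsHilbertSchmidt (DNLS.Lam κ q) ∧
          DNLS.IsHilbertSchmidt (DNLS.Gam κ (DNLS.negConj q)) ∧
          (∀ m : ℕ, 1 ≤ m →
            DNLS.IsTraceClass ((DNLS.Lam κ q ∘L DNLS.Gam κ (DNLS.negConj q)) ^ m)) ∧
          Summable fun m : ℕ => ‖DNLS.Aterm κ q (DNLS.negConj q) (m + 1)‖) ∧
        -- the expansion as `|κ| → ∞` with `iκ² ∈ ℝ`
        (fun κ : ℂ => DNLS.A κ q (DNLS.negConj q)
            - ((-I) * (DNLS.mass q (DNLS.negConj q) / 2)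
              - (-I) ^ 2 / (2 * I * κ ^ 2) * (DNLS.hamiltonian q (DNLS.negConj q) / 2)
              + (-I) ^ 3 / (2 * I * κ ^ 2) ^ 2 * (DNLS.energy q (DNLS.negConj q) / 2)))
          =O[Bornology.cobounded ℂ ⊓ 𝓟 DNLS.spectralSet] fun κ : ℂ => ‖κ‖ ^ (-6 : ℤ) := by
  open DNLS in
  refine ⟨1, one_pos, fun s hs0 hs1 q hq => ?_⟩
  have hq1 : ‖q.toLp 2 (volume : Measure ℝ)‖ ≤ 1 :=
    (norm_toLp_le_sobolevNorm q hs0 (by linarith)).trans hq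
  have hr1 : ‖(snegConj q).toLp 2 (volume : Measure ℝ)‖ ≤ 1 := by
    rwa [norm_snegConj_toLp]
  rw [coe_snegConj]
  refine ⟨fun κ hκ hκ1 => ?_, ?_⟩
  · have hL := (small_hs hκ hκ1 hq1).1.1
    have hG := (small_hs hκ hκ1 hr1).2.1
    refine ⟨hL, hG, fun m hm => ?_, summable_norm_Aterm hκ hκ1 hq1 hr1⟩
    obtain ⟨k, rfl⟩ := Nat.exists_eq_add_of_le' hm
    exact isTraceClass_pow hL hG k
  · obtain ⟨C, hC, hhead⟩ := head_expansion q (snegConj q)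
    refine IsBigO.of_bound (C + (‖mulOp q‖ * ‖mulOp (snegConj q)‖) ^ 3) ?_
    have hev : ∀ᶠ κ in Bornology.cobounded ℂ ⊓ 𝓟 spectralSet, 1 ≤ ‖κ‖ ∧ κ ∈ spectralSet :=
      (((tendsto_norm_cobounded_atTop.eventually (eventually_ge_atTop 1)).filter_mono
        inf_le_left)).and (mem_inf_of_right (mem_principal_self _))
    filter_upwards [hev] with κ hκ
    obtain ⟨hκ1, hκ⟩ := hκ
    have h1 := hhead κ hκ hκ1
    have h2 := norm_A_sub_head_le hκ hκ1 hq1 hr1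
    have h3 : ‖(‖κ‖ ^ (-6 : ℤ) : ℝ)‖ = |par κ|⁻¹ ^ 3 := by
      rw [Real.norm_of_nonneg (by positivity), abs_par hκ, zpow_neg, inv_pow, ← pow_mul]
      norm_cast
    rw [h3, add_mul, add_comm (C * _)]
    refine (le_of_eq ?_).trans ((norm_add_le _ _).trans (add_le_add h2 h1))
    congr 1
    ring
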